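/- Theorem. There is a universal constant $C\in\mathbb{R}$ with the following property. Let $(M,g)$ be a connected smooth Riemannian manifold (without boundary) of dimension $n\ge 3$, with Ricci tensor $\mathrm{Ric}$, scalar curvature $R$, Riemannian distance and Riemannian volume measure $dV$. Suppose that $(M,g,f,\frac1n)$ is a non-expanding gradient traceless Ricci soliton, that is, $f:M\to\mathbb{R}$ is smooth and $$\mathrm{Ric}+\mathrm{Hess}(f)-\frac{1}{n}R\,g=\lambda g$$ for a constant $\lambda\ge 0$. Suppose moreover that the potential function satisfies $f\ge 0$. Then for every $q\in M$ and every $r>0$ such that the open geodesic ball $B(q,2r)$ has compact closure in $M$ (which holds for all $q$ and $r$ if $M$ is complete), the functions $|\nabla f|^2$ and $f^2$ are integrable over $B(q,r)$ and $B(q,2r)$ respectively, and $$\int_{B(q,r)}|\nabla f|^2\,dV\le\frac{C}{r^2}\int_{B(q,2r)}f^2\,dV .$$ -/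

import Mathlib

open MeasureTheory Bundle
open scoped Manifold ContDiff Bundle

universe u

noncomputable section

namespace RiemSoliton

/-! Throughout, `n` is the dimension, the model space is `ℝⁿ = EuclideanSpace ℝ (Fin n)`, and a chart
of `M` is an open partial homeomorphism `e` from `M` to `ℝⁿ`. Coordinate expressions are functions of
`y : ℝⁿ`, meaningful for `y ∈ e.target`. -/

/-- The partial derivative `∂ᵢ u` of a function on `ℝⁿ`. -/
def partialD {n : ℕ} (i : Fin n) (u : EuclideanSpace ℝ (Fin n) → ℝ)
    (y : EuclideanSpace ℝ (Fin n)) : ℝ :=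
  fderiv ℝ u y (EuclideanSpace.single i 1)

section Coordinates

variable {n : ℕ} {M : Type u} [TopologicalSpace M] [ChartedSpace (EuclideanSpace ℝ (Fin n)) M]

/-- The coordinate vector field `∂ᵢ` of the chart `e`, at the point with coordinates `y`. -/
def coordVec (e : OpenPartialHomeomorph M (EuclideanSpace ℝ (Fin n))) (i : Fin n)
    (y : EuclideanSpace ℝ (Fin n)) : TangentSpace (𝓡 n) (e.symm y) :=
  mfderiv (𝓡 n) (𝓡 n) e.symm y (EuclideanSpace.single i (1 : ℝ) : EuclideanSpace ℝ (Fin n))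

variable [IsManifold (𝓡 n) ∞ M] [RiemannianBundle (fun x : M ↦ TangentSpace (𝓡 n) x)]

/-- The matrix `g i j = ⟨∂ᵢ, ∂ⱼ⟩` of the metric in the chart `e`. -/
def metricCoord (e : OpenPartialHomeomorph M (EuclideanSpace ℝ (Fin n)))
    (y : EuclideanSpace ℝ (Fin n)) : Matrix (Fin n) (Fin n) ℝ :=
  Matrix.of fun i j ↦ inner ℝ (coordVec e i y) (coordVec e j y)

/-- The Christoffel symbol
`Γᵏᵢⱼ = 1/2 ∑ₗ gᵏˡ (∂ᵢ gⱼₗ + ∂ⱼ gᵢₗ - ∂ₗ gᵢⱼ)` in the chart `e`. -/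
def christoffel (e : OpenPartialHomeomorph M (EuclideanSpace ℝ (Fin n))) (k i j : Fin n)
    (y : EuclideanSpace ℝ (Fin n)) : ℝ :=
  (1 / 2 : ℝ) * ∑ l, (metricCoord e y)⁻¹ k l *
    (partialD i (fun z ↦ metricCoord e z j l) y + partialD j (fun z ↦ metricCoord e z i l) y
      - partialD l (fun z ↦ metricCoord e z i j) y)

/-- The components
`Rᵢⱼ = ∑ₖ (∂ₖ Γᵏᵢⱼ - ∂ⱼ Γᵏᵢₖ) + ∑ₖₗ (Γᵏₖₗ Γˡᵢⱼ - Γᵏⱼₗ Γˡᵢₖ)` of the Ricci tensor in the chart `e`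
(the sign is such that round spheres have positive Ricci curvature). -/
def ricciCoord (e : OpenPartialHomeomorph M (EuclideanSpace ℝ (Fin n)))
    (y : EuclideanSpace ℝ (Fin n)) : Matrix (Fin n) (Fin n) ℝ :=
  Matrix.of fun i j ↦
    ∑ k, (partialD k (christoffel e k i j) y - partialD j (christoffel e k i k) y)
      + ∑ k, ∑ l, (christoffel e k k l y * christoffel e l i j y
          - christoffel e k j l y * christoffel e l i k y)

/-- The scalar curvature `R = ∑ᵢⱼ gⁱʲ Rᵢⱼ` in the chart `e`. -/
def scalarCoord (e : OpenPartialHomeomorph M (EuclideanSpace ℝ (Fin n)))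
    (y : EuclideanSpace ℝ (Fin n)) : ℝ :=
  ∑ i, ∑ j, (metricCoord e y)⁻¹ i j * ricciCoord e y i j

/-- The components `∂ᵢ ∂ⱼ f - ∑ₖ Γᵏᵢⱼ ∂ₖ f` of the Hessian of `f` in the chart `e`. -/
def hessianCoord (e : OpenPartialHomeomorph M (EuclideanSpace ℝ (Fin n))) (f : M → ℝ)
    (y : EuclideanSpace ℝ (Fin n)) : Matrix (Fin n) (Fin n) ℝ :=
  Matrix.of fun i j ↦
    partialD i (partialD j (fun z ↦ f (e.symm z))) y
      - ∑ k, christoffel e k i j y * partialD k (fun z ↦ f (e.symm z)) y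

/-- `(M, g, f, ρ)` is a gradient `ρ`-Einstein soliton with constant `lam`: the dimension is at least
three, `ρ ≠ 0`, `f` is smooth, and `Ric + Hess f - ρ R g = lam g`, an equality of tensors that is
expressed in all smooth local coordinate systems. -/
structure IsGradientEinsteinSoliton (f : M → ℝ) (ρ lam : ℝ) : Prop where
  dim : 3 ≤ n
  rho_ne_zero : ρ ≠ 0
  smooth : ContMDiff (𝓡 n) 𝓘(ℝ) ∞ f
  equation : ∀ e ∈ IsManifold.maximalAtlas (𝓡 n) ∞ M, ∀ y ∈ e.target,
    ricciCoord e y + hessianCoord e f y - (ρ * scalarCoord e y) • metricCoord e y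
      = lam • metricCoord e y

/-- A gradient traceless Ricci soliton with constant `lam`: the case `ρ = 1 / n`. -/
def IsGradientTracelessRicciSoliton (f : M → ℝ) (lam : ℝ) : Prop :=
  IsGradientEinsteinSoliton (n := n) f (1 / (n : ℝ)) lam

/-- The Riemannian volume on the domain of the chart `e`: the image under `e⁻¹` of
`√(det g) dy¹ ⋯ dyⁿ` on the target of `e`. -/
def chartVolume [MeasurableSpace M] (e : OpenPartialHomeomorph M (EuclideanSpace ℝ (Fin n))) :
    Measure M :=
  ((volume.restrict e.target).withDensity
    fun y ↦ ENNReal.ofReal (Real.sqrt (metricCoord e y).det)).map e.symm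

variable (n M) in
/-- The Riemannian volume measure. By the change of variables formula the chart volumes agree where
the domains of two charts overlap; the measure they glue to (on a second countable manifold) is
their supremum. -/
def riemannianVolume [MeasurableSpace M] : Measure M :=
  ⨆ e ∈ IsManifold.maximalAtlas (𝓡 n) ∞ M, chartVolume e

variable (n) in
/-- The gradient of `f`: the tangent vector with `⟨∇f, v⟩ = df(v)` for all `v`. -/
def gradient (f : M → ℝ) (x : M) : TangentSpace (𝓡 n) x :=
  haveI : FiniteDimensional ℝ (TangentSpace (𝓡 n) x) :=
    inferInstanceAs (FiniteDimensional ℝ (EuclideanSpace ℝ (Fin n)))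
  haveI : CompleteSpace (TangentSpace (𝓡 n) x) := FiniteDimensional.complete ℝ _
  (InnerProductSpace.toDual ℝ (TangentSpace (𝓡 n) x)).symm (mfderiv (𝓡 n) 𝓘(ℝ) f x)

end Coordinates

end RiemSoliton

end

namespace RiemSoliton

open Matrix Filter Topology Set
open scoped ENNReal NNReal

set_option linter.unusedSectionVars false

/-! ### Matrix calculus and the divergence form of the Laplacian in coordinates. -/

section CoordinateCalculus

variable {n : ℕ}

/-! Tracing the soliton equation with `ρ = 1 / n` makes the scalar curvature cancel and leaves `Δf =
nλ ≥ 0` (`sum_inv_mul_hessianCoord`). So `f` is a nonnegative subharmonic function, and the estimate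
is its Caccioppoli inequality. Let `φ` be a `1/r`-Lipschitz cutoff equal to `1` on `B(q,r)` and to
`0` off `B(q,2r)`. Testing `Δf = nλ` against `φ²f` gives `∫ ⟨∇f, ∇(φ²f)⟩ = -nλ ∫ φ²f ≤ 0`. Expanding
the left side, `∫ φ²|∇f|² ≤ -2 ∫ φ f ⟨∇f, ∇φ⟩`; by Young's inequality and `|∇φ| ≤ 1/r` the right
side is at most `½ ∫ φ²|∇f|² + (2/r²) ∫_{B(q,2r)} f²`. Absorbing the first term yields `C = 4`.

The work lies in justifying the integration by parts for a cutoff that is only Lipschitz. Three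
facts carry it. The Laplacian has divergence form in coordinates (`sum_partialD_sqrt_det_mul_grad`).
The measure defined as a supremum is, on each chart domain, the density `√(det g) dy`
(`riemannianVolume_restrict_source`). Functions Lipschitz for the Riemannian distance are locally
Lipschitz in charts, hence differentiable almost everywhere by Rademacher, with `|⟨∇f, ∇φ⟩| ≤ K|∇f|`
(`abs_gradDeriv_le`). Green's formula then holds for test functions supported in one chart, and a
partition of unity handles `φ²f`. -/

theorem contDiffAt_matrix_det {E : Type*} [NormedAddCommGroup E] [NormedSpace ℝ E] {k : ℕ∞ω}
    {A : E → Matrix (Fin n) (Fin n) ℝ} {y : E}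
    (hA : ∀ a b, ContDiffAt ℝ k (fun z ↦ A z a b) y) :
    ContDiffAt ℝ k (fun z ↦ (A z).det) y := by
  simp only [Matrix.det_apply]
  refine ContDiffAt.sum fun σ _ ↦ ContDiffAt.const_smul _ ?_
  exact contDiffAt_prod fun a _ ↦ hA _ _

theorem contDiffAt_matrix_inv {E : Type*} [NormedAddCommGroup E] [NormedSpace ℝ E] {k : ℕ∞ω}
    {A : E → Matrix (Fin n) (Fin n) ℝ} {y : E}
    (hA : ∀ a b, ContDiffAt ℝ k (fun z ↦ A z a b) y) (hdet : (A y).det ≠ 0) (a b : Fin n) :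
    ContDiffAt ℝ k (fun z ↦ (A z)⁻¹ a b) y := by
  have hadj : ContDiffAt ℝ k (fun z ↦ (A z).adjugate a b) y := by
    simp only [Matrix.adjugate_apply]
    refine contDiffAt_matrix_det fun c d ↦ ?_
    by_cases hc : c = b
    · subst hc
      simpa using contDiffAt_const
    · simpa [Matrix.updateRow_ne hc] using hA c d
  simpa [Matrix.inv_def, Ring.inverse_eq_inv'] using
    ((contDiffAt_matrix_det hA).inv hdet).mul hadj

/-- Jacobi's formula for the derivative of the determinant. -/
theorem hasDerivAt_det_line (A B : Matrix (Fin n) (Fin n) ℝ) (hA : A.det ≠ 0) :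
    HasDerivAt (fun t : ℝ ↦ (A + t • B).det) (A.det * (A⁻¹ * B).trace) 0 := by
  have hfac (t : ℝ) : (A + t • B).det = A.det * (1 + t • (A⁻¹ * B)).det := by
    rw [← Matrix.det_mul, mul_add, mul_one, Matrix.mul_smul, ← mul_assoc,
      Matrix.mul_nonsing_inv _ (isUnit_iff_ne_zero.mpr hA), one_mul]
  simp_rw [hfac]
  apply HasDerivAt.const_mul
  -- The determinant of `1 + tX` is `1 + t tr X + p(t) t²` with `p` a polynomial, so only the trace
  -- survives in the derivative at `0`.
  rw [funext fun t : ℝ ↦ Matrix.det_one_add_smul t (A⁻¹ * B)]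
  set p := (Matrix.det (1 + (Polynomial.X : Polynomial ℝ) •
    (A⁻¹ * B).map Polynomial.C)).divX.divX
  have h := (((hasDerivAt_id (0 : ℝ)).const_mul (A⁻¹ * B).trace).const_add 1).add
    ((p.hasDerivAt 0).mul ((hasDerivAt_id (0 : ℝ)).pow 2))
  convert! h using 1
  simp

theorem fderiv_matrix_det {E : Type*} [NormedAddCommGroup E] [NormedSpace ℝ E]
    {A : E → Matrix (Fin n) (Fin n) ℝ} {y : E}
    (hA : ∀ a b, DifferentiableAt ℝ (fun z ↦ A z a b) y) (hdet : (A y).det ≠ 0) (v : E) :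
    fderiv ℝ (fun z ↦ (A z).det) y v =
      (A y).det * ((A y)⁻¹ * Matrix.of fun a b ↦ fderiv ℝ (fun z ↦ A z a b) y v).trace := by
  -- The space `Fin n → Fin n → ℝ` of entries carries the norm in which the chain rule is applied.
  let F : (Fin n → Fin n → ℝ) → ℝ := fun B ↦ (Matrix.of B).det
  have hF : Differentiable ℝ F := by
    intro B
    refine (contDiffAt_matrix_det (k := 1) (A := fun B : Fin n → Fin n → ℝ ↦ Matrix.of B)
      fun a b ↦ ?_).differentiableAt one_ne_zero
    simp only [Matrix.of_apply]
    fun_prop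
  let A' : E → Fin n → Fin n → ℝ := fun z a b ↦ A z a b
  have hA' : DifferentiableAt ℝ A' y := by
    rw [differentiableAt_pi]; intro a; rw [differentiableAt_pi]; exact hA a
  have h1 : fderiv ℝ (fun z ↦ (A z).det) y v = fderiv ℝ F (A' y) (fderiv ℝ A' y v) := by
    have := fderiv_comp y (hF (A' y)) hA'
    exact congrArg (fun L ↦ L v) this
  have h2 : fderiv ℝ A' y v = fun a b ↦ fderiv ℝ (fun z ↦ A z a b) y v := by
    have hr : ∀ a, DifferentiableAt ℝ (fun z ↦ A' z a) y := fun a ↦ by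
      rw [differentiableAt_pi]; exact hA a
    ext a b
    rw [fderiv_pi hr]
    simp only [ContinuousLinearMap.pi_apply]
    rw [fderiv_pi (hA a)]
    rfl
  rw [h1, h2]
  have h3 : HasLineDerivAt ℝ F _ _ _ := (hF (A' y)).hasFDerivAt.hasLineDerivAt
    (fun a b ↦ fderiv ℝ (fun z ↦ A z a b) y v)
  exact HasDerivAt.unique h3 (hasDerivAt_det_line (A y)
    (Matrix.of fun a b ↦ fderiv ℝ (fun z ↦ A z a b) y v) hdet)

theorem partialD_mul {i : Fin n} {u v : EuclideanSpace ℝ (Fin n) → ℝ}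
    {y : EuclideanSpace ℝ (Fin n)}
    (hu : DifferentiableAt ℝ u y) (hv : DifferentiableAt ℝ v y) :
    partialD i (fun z ↦ u z * v z) y = partialD i u y * v y + u y * partialD i v y := by
  simp [partialD, fderiv_fun_mul hu hv]; ring

theorem partialD_sum {ι : Type*} {i : Fin n} {s : Finset ι}
    {u : ι → EuclideanSpace ℝ (Fin n) → ℝ} {y : EuclideanSpace ℝ (Fin n)}
    (hu : ∀ k ∈ s, DifferentiableAt ℝ (u k) y) :
    partialD i (fun z ↦ ∑ k ∈ s, u k z) y = ∑ k ∈ s, partialD i (u k) y := by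
  simp [partialD, fderiv_fun_sum hu]

variable {G : EuclideanSpace ℝ (Fin n) → Matrix (Fin n) (Fin n) ℝ}
  {y : EuclideanSpace ℝ (Fin n)}

/-- Differentiate `G G⁻¹ = 1`, which holds near `y` because the determinant stays nonzero there. -/
theorem partialD_matrix_inv (hG : ∀ a b, ContDiffAt ℝ 1 (fun z ↦ G z a b) y)
    (hdet : (G y).det ≠ 0) (i a b : Fin n) :
    partialD i (fun z ↦ (G z)⁻¹ a b) y =
      -((G y)⁻¹ * (Matrix.of fun c d ↦ partialD i (fun z ↦ G z c d) y) * (G y)⁻¹) a b := by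
  have hGd a b : DifferentiableAt ℝ (fun z ↦ G z a b) y := (hG a b).differentiableAt one_ne_zero
  have hId a b : DifferentiableAt ℝ (fun z ↦ (G z)⁻¹ a b) y :=
    (contDiffAt_matrix_inv hG hdet a b).differentiableAt one_ne_zero
  set D : Matrix (Fin n) (Fin n) ℝ := Matrix.of fun c d ↦ partialD i (fun z ↦ G z c d) y with hD
  set D' : Matrix (Fin n) (Fin n) ℝ := Matrix.of fun c d ↦ partialD i (fun z ↦ (G z)⁻¹ c d) y
    with hD'
  have hu : IsUnit (G y).det := isUnit_iff_ne_zero.mpr hdet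
  have hev : ∀ᶠ z in 𝓝 y, IsUnit (G z).det := by
    have := ((contDiffAt_matrix_det hG).continuousAt).eventually_ne hdet
    filter_upwards [this] with z hz using isUnit_iff_ne_zero.mpr hz
  have key : D * (G y)⁻¹ + G y * D' = 0 := by
    ext c d
    have h1 : partialD i (fun z ↦ ∑ k, G z c k * (G z)⁻¹ k d) y = 0 := by
      have : (fun z ↦ ∑ k, G z c k * (G z)⁻¹ k d) =ᶠ[𝓝 y]
          fun _ ↦ (1 : Matrix (Fin n) (Fin n) ℝ) c d := by
        filter_upwards [hev] with z hz
        rw [← Matrix.mul_nonsing_inv _ hz, Matrix.mul_apply]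
      simp [partialD, this.fderiv_eq]
    rw [partialD_sum (u := fun k z ↦ G z c k * (G z)⁻¹ k d)
      fun k _ ↦ (hGd c k).mul (hId k d)] at h1
    simp_rw [partialD_mul (hGd c _) (hId _ d), Finset.sum_add_distrib] at h1
    simpa [Matrix.add_apply, Matrix.mul_apply, hD, hD'] using h1
  have : D' = -((G y)⁻¹ * D * (G y)⁻¹) := by
    have h2 : (G y)⁻¹ * (D * (G y)⁻¹ + G y * D') = 0 := by rw [key, mul_zero]
    rw [mul_add, ← mul_assoc, ← mul_assoc, Matrix.nonsing_inv_mul _ hu, one_mul] at h2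
    exact eq_neg_of_add_eq_zero_right h2
  exact congrFun (congrFun this a) b

theorem partialD_sqrt_det (hG : ∀ a b, ContDiffAt ℝ 1 (fun z ↦ G z a b) y)
    (hdet : 0 < (G y).det) (i : Fin n) :
    partialD i (fun z ↦ √(G z).det) y =
      √(G y).det * (1 / 2 * ∑ a, ∑ b, (G y)⁻¹ a b * partialD i (fun z ↦ G z b a) y) := by
  have hGd a b : DifferentiableAt ℝ (fun z ↦ G z a b) y := (hG a b).differentiableAt one_ne_zero
  have hd : DifferentiableAt ℝ (fun z ↦ (G z).det) y :=
    (contDiffAt_matrix_det hG).differentiableAt one_ne_zero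
  have h1 : partialD i (fun z ↦ (G z).det) y =
      (G y).det * ∑ a, ∑ b, (G y)⁻¹ a b * partialD i (fun z ↦ G z b a) y := by
    rw [partialD, fderiv_matrix_det hGd hdet.ne']
    simp [Matrix.trace, Matrix.mul_apply, partialD]
  have h2 : partialD i (fun z ↦ √(G z).det) y =
      1 / (2 * √(G y).det) * partialD i (fun z ↦ (G z).det) y := by
    simp [partialD, fderiv_sqrt hd hdet.ne']
  have hs : √(G y).det ≠ 0 := (Real.sqrt_pos.mpr hdet).ne'
  have hss : (G y).det = √(G y).det * √(G y).det := (Real.mul_self_sqrt hdet.le).symm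
  rw [h2, h1]
  set X := ∑ a, ∑ b, (G y)⁻¹ a b * partialD i (fun z ↦ G z b a) y
  calc 1 / (2 * √(G y).det) * ((G y).det * X)
      = 1 / (2 * √(G y).det) * ((√(G y).det * √(G y).det) * X) := by rw [← hss]
    _ = _ := by field_simp

theorem sum_comm₃ {R : Type*} [AddCommMonoid R] (F : Fin n → Fin n → Fin n → R) :
    ∑ i, ∑ j, ∑ l, F i j l = ∑ l, ∑ i, ∑ j, F i j l := by
  calc ∑ i, ∑ j, ∑ l, F i j l = ∑ i, ∑ l, ∑ j, F i j l :=
        Finset.sum_congr rfl fun i _ ↦ Finset.sum_comm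
    _ = _ := Finset.sum_comm

/-- With `b` the inverse metric and `D i j l = ∂ᵢ gⱼₗ`, this is `(1/√g) ∂ᵢ(√g gⁱᵏ) = -gⁱʲ Γᵏᵢⱼ`. By
symmetry both sides equal `½S - T`, where `T = ∑ b i j * b k l * D i j l` and `S = ∑ b i j * b k l *
D l i j`. -/
theorem christoffel_contraction (b : Fin n → Fin n → ℝ) (D : Fin n → Fin n → Fin n → ℝ)
    (hb : ∀ i j, b i j = b j i) (hD : ∀ i j l, D i j l = D i l j) (k : Fin n) :
    ∑ i, ((1 / 2 * ∑ a, ∑ c, b a c * D i c a) * b i k - ∑ d, ∑ c, b i c * D i c d * b d k) =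
      -∑ i, ∑ j, b i j * (1 / 2 * ∑ l, b k l * (D i j l + D j i l - D l i j)) := by
  have h1 : ∑ i, ∑ j, ∑ l, b i j * b k l * D j i l = ∑ i, ∑ j, ∑ l, b i j * b k l * D i j l := by
    rw [Finset.sum_comm]
    exact Finset.sum_congr rfl fun i _ ↦ Finset.sum_congr rfl fun j _ ↦
      Finset.sum_congr rfl fun l _ ↦ by rw [hb i j]
  have h2 : ∑ i, ∑ d, ∑ c, b i c * D i c d * b d k = ∑ i, ∑ j, ∑ l, b i j * b k l * D i j l := by
    refine Finset.sum_congr rfl fun i _ ↦ ?_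
    rw [Finset.sum_comm]
    exact Finset.sum_congr rfl fun j _ ↦ Finset.sum_congr rfl fun l _ ↦ by rw [hb k l]; ring
  have h3 : ∑ i, (1 / 2 * ∑ a, ∑ c, b a c * D i c a) * b i k =
      1 / 2 * ∑ i, ∑ j, ∑ l, b i j * b k l * D l i j := by
    rw [sum_comm₃, Finset.mul_sum]
    refine Finset.sum_congr rfl fun i _ ↦ ?_
    rw [mul_assoc, Finset.sum_mul]
    simp_rw [Finset.sum_mul]
    congr 1
    exact Finset.sum_congr rfl fun j _ ↦ Finset.sum_congr rfl fun l _ ↦ by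
      rw [hb k i, hD i l j]; ring
  have h4 : ∑ i, ∑ j, b i j * (1 / 2 * ∑ l, b k l * (D i j l + D j i l - D l i j)) =
      1 / 2 * (∑ i, ∑ j, ∑ l, b i j * b k l * D i j l + ∑ i, ∑ j, ∑ l, b i j * b k l * D j i l
        - ∑ i, ∑ j, ∑ l, b i j * b k l * D l i j) := by
    simp_rw [← Finset.sum_add_distrib, ← Finset.sum_sub_distrib, Finset.mul_sum]
    exact Finset.sum_congr rfl fun i _ ↦ Finset.sum_congr rfl fun j _ ↦
      Finset.sum_congr rfl fun l _ ↦ by ring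
  rw [Finset.sum_sub_distrib, h2, h3, h4, h1]
  ring

/-- The coordinate divergence formula for the Laplacian:
`∑ᵢ ∂ᵢ (√(det G) ∑ⱼ Gⁱʲ ∂ⱼ h) = √(det G) ∑ᵢⱼ Gⁱʲ (∂ᵢ ∂ⱼ h - ∑ₖ Γᵏᵢⱼ ∂ₖ h)`. -/
theorem sum_partialD_sqrt_det_mul_grad (hG : ∀ a b, ContDiffAt ℝ 1 (fun z ↦ G z a b) y)
    (hsymm : ∀ z a b, G z a b = G z b a) (hdet : 0 < (G y).det)
    {h : EuclideanSpace ℝ (Fin n) → ℝ} (hh : ∀ j, DifferentiableAt ℝ (partialD j h) y) :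
    ∑ i, partialD i (fun z ↦ √(G z).det * ∑ j, (G z)⁻¹ i j * partialD j h z) y =
      √(G y).det * ∑ i, ∑ j, (G y)⁻¹ i j * (partialD i (partialD j h) y
        - ∑ k, ((1 / 2 : ℝ) * ∑ l, (G y)⁻¹ k l * (partialD i (fun z ↦ G z j l) y
          + partialD j (fun z ↦ G z i l) y - partialD l (fun z ↦ G z i j) y))
            * partialD k h y) := by
  have hId a b : DifferentiableAt ℝ (fun z ↦ (G z)⁻¹ a b) y :=
    (contDiffAt_matrix_inv hG hdet.ne' a b).differentiableAt one_ne_zero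
  have hd : DifferentiableAt ℝ (fun z ↦ √(G z).det) y :=
    ((contDiffAt_matrix_det hG).differentiableAt one_ne_zero).sqrt hdet.ne'
  have hb i j : (G y)⁻¹ i j = (G y)⁻¹ j i := by
    have : (G y)ᵀ = G y := by ext a b; exact hsymm y b a
    rw [← Matrix.transpose_apply (G y)⁻¹ j i, Matrix.transpose_nonsing_inv, this]
  set D : Fin n → Fin n → Fin n → ℝ := fun i a b ↦ partialD i (fun z ↦ G z a b) y with hDdef
  have hD i a b : D i a b = D i b a := by simp only [hDdef, hsymm _ a b]
  set b := (G y)⁻¹ with hbdef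
  have hterm i : partialD i (fun z ↦ √(G z).det * ∑ j, (G z)⁻¹ i j * partialD j h z) y =
      √(G y).det * (∑ k, ((1 / 2 * ∑ a, ∑ c, b a c * D i c a) * b i k
        - ∑ d, ∑ c, b i c * D i c d * b d k) * partialD k h y
        + ∑ j, b i j * partialD i (partialD j h) y) := by
    rw [partialD_mul hd (DifferentiableAt.fun_sum fun j _ ↦ (hId i j).fun_mul (hh j)),
      partialD_sum (u := fun j z ↦ (G z)⁻¹ i j * partialD j h z)
        fun j _ ↦ (hId i j).mul (hh j), partialD_sqrt_det hG hdet]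
    simp_rw [partialD_mul (hId i _) (hh _), partialD_matrix_inv hG hdet.ne']
    rw [mul_assoc, ← mul_add]
    congr 1
    rw [Finset.sum_add_distrib, ← add_assoc]
    congr 1
    rw [Finset.mul_sum, ← Finset.sum_add_distrib]
    refine Finset.sum_congr rfl fun k _ ↦ ?_
    simp only [Matrix.mul_apply, Matrix.of_apply, Finset.sum_mul, hDdef, ← hbdef]
    ring
  simp_rw [hterm]
  -- The second-order terms already agree; this matches the coefficients of each `∂ₖ h`.
  have hcon : ∑ i, ∑ k, ((1 / 2 * ∑ a, ∑ c, b a c * D i c a) * b i k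
      - ∑ d, ∑ c, b i c * D i c d * b d k) * partialD k h y =
      -∑ i, ∑ j, b i j * ∑ k, ((1 / 2 : ℝ) * ∑ l, b k l * (D i j l + D j i l - D l i j))
        * partialD k h y := by
    simp_rw [Finset.mul_sum (s := Finset.univ) (f := fun k ↦
      ((1 / 2 : ℝ) * ∑ l, b k l * (D _ _ l + D _ _ l - D l _ _)) * partialD k h y)]
    rw [Finset.sum_comm, sum_comm₃, ← Finset.sum_neg_distrib]
    refine Finset.sum_congr rfl fun k _ ↦ ?_
    rw [← Finset.sum_mul, christoffel_contraction b D hb hD k, neg_mul, Finset.sum_mul]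
    simp_rw [Finset.sum_mul, mul_assoc]
  rw [← Finset.mul_sum, Finset.sum_add_distrib, hcon]
  simp_rw [mul_sub, Finset.sum_sub_distrib]
  ring

end CoordinateCalculus

/-! ### The metric, gradient and traced soliton equation in a chart. -/

section Charts

variable {n : ℕ} {M : Type u} [TopologicalSpace M] [ChartedSpace (EuclideanSpace ℝ (Fin n)) M]
  [IsManifold (𝓡 n) ∞ M]
  {e : OpenPartialHomeomorph M (EuclideanSpace ℝ (Fin n))}

theorem mdifferentiableAt_chart_symm (he : e ∈ IsManifold.maximalAtlas (𝓡 n) ∞ M)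
    {y : EuclideanSpace ℝ (Fin n)} (hy : y ∈ e.target) :
    MDifferentiableAt (𝓡 n) (𝓡 n) e.symm y :=
  ((contMDiffOn_symm_of_mem_maximalAtlas he).contMDiffAt
    (e.open_target.mem_nhds hy)).mdifferentiableAt (by simp)

theorem mdifferentiableAt_chart (he : e ∈ IsManifold.maximalAtlas (𝓡 n) ∞ M)
    {x : M} (hx : x ∈ e.source) : MDifferentiableAt (𝓡 n) (𝓡 n) e x :=
  ((contMDiffOn_of_mem_maximalAtlas he).contMDiffAt
    (e.open_source.mem_nhds hx)).mdifferentiableAt (by simp)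

theorem mfderiv_chart_comp_symm (he : e ∈ IsManifold.maximalAtlas (𝓡 n) ∞ M)
    {y : EuclideanSpace ℝ (Fin n)} (hy : y ∈ e.target) (v : EuclideanSpace ℝ (Fin n)) :
    mfderiv (𝓡 n) (𝓡 n) e (e.symm y) (mfderiv (𝓡 n) (𝓡 n) e.symm y v) = v := by
  have h1 := mfderiv_comp y (mdifferentiableAt_chart he (e.map_target hy))
    (mdifferentiableAt_chart_symm he hy)
  have h2 : (e ∘ e.symm) =ᶠ[𝓝 y] id := by
    filter_upwards [e.open_target.mem_nhds hy] with z hz using e.right_inv hz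
  rw [h2.mfderiv_eq, mfderiv_id] at h1
  exact (congrArg (fun L ↦ L v) h1).symm

/-- The differential of `e` is a left inverse, so that of `e.symm` is injective, hence surjective by
equality of dimensions. -/
theorem mfderiv_symm_comp_chart (he : e ∈ IsManifold.maximalAtlas (𝓡 n) ∞ M)
    {y : EuclideanSpace ℝ (Fin n)} (hy : y ∈ e.target) (v : TangentSpace (𝓡 n) (e.symm y)) :
    ∃ w : EuclideanSpace ℝ (Fin n), mfderiv (𝓡 n) (𝓡 n) e.symm y w = v := by
  have hinj : Function.Injective (fun v : EuclideanSpace ℝ (Fin n) ↦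
      (mfderiv (𝓡 n) (𝓡 n) e.symm y v : EuclideanSpace ℝ (Fin n))) := fun v w h ↦ by
    have := congrArg (mfderiv (𝓡 n) (𝓡 n) e (e.symm y)) h
    rwa [mfderiv_chart_comp_symm he hy, mfderiv_chart_comp_symm he hy] at this
  let L : EuclideanSpace ℝ (Fin n) →L[ℝ] EuclideanSpace ℝ (Fin n) :=
    mfderiv (𝓡 n) (𝓡 n) e.symm y
  exact (LinearMap.injective_iff_surjective (f := L.toLinearMap)).mp hinj v

variable [RiemannianBundle (fun x : M ↦ TangentSpace (𝓡 n) x)]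

/-- A constant vector field on `ℝⁿ` is pushed forward by the tangent map of `e.symm` to a smooth map
into the tangent bundle, on which the metric is smooth. -/
theorem contDiffOn_inner_mfderiv_symm
    [IsContMDiffRiemannianBundle (𝓡 n) ∞ (EuclideanSpace ℝ (Fin n))
      (fun x : M ↦ TangentSpace (𝓡 n) x)]
    (he : e ∈ IsManifold.maximalAtlas (𝓡 n) ∞ M) (v w : EuclideanSpace ℝ (Fin n)) :
    ContDiffOn ℝ ∞ (fun y ↦ (inner ℝ
      (mfderiv (𝓡 n) (𝓡 n) e.symm y v : TangentSpace (𝓡 n) (e.symm y))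
      (mfderiv (𝓡 n) (𝓡 n) e.symm y w) : ℝ)) e.target := by
  have key (v : EuclideanSpace ℝ (Fin n)) :
      ContMDiffOn (𝓡 n) ((𝓡 n).prod (𝓡 n)) ∞ (fun y : EuclideanSpace ℝ (Fin n) ↦
        (⟨e.symm y, mfderiv (𝓡 n) (𝓡 n) e.symm y v⟩ :
          TotalSpace (EuclideanSpace ℝ (Fin n)) (fun x : M ↦ TangentSpace (𝓡 n) x)))
        e.target := by
    have h1 := (contMDiffOn_symm_of_mem_maximalAtlas he).contMDiffOn_tangentMapWithin
      (m := ∞) (by simp) e.open_target.uniqueMDiffOn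
    have h2 : ContMDiff (𝓡 n) (𝓡 n).tangent ∞ (fun y : EuclideanSpace ℝ (Fin n) ↦
        (⟨y, v⟩ : TangentBundle (𝓡 n) (EuclideanSpace ℝ (Fin n)))) := by
      intro y
      rw [contMDiffAt_totalSpace]
      refine ⟨contMDiffAt_id, ?_⟩
      simpa using contMDiffAt_const
    refine (h1.comp h2.contMDiffOn (fun y hy ↦ hy)).congr fun y hy ↦ ?_
    simp [tangentMapWithin, mfderivWithin_of_isOpen e.open_target hy]
  rw [← contMDiffOn_iff_contDiffOn]
  exact (key v).inner_bundle (key w)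

theorem contDiffOn_metricCoord
    [IsContMDiffRiemannianBundle (𝓡 n) ∞ (EuclideanSpace ℝ (Fin n))
      (fun x : M ↦ TangentSpace (𝓡 n) x)]
    (he : e ∈ IsManifold.maximalAtlas (𝓡 n) ∞ M) (i j : Fin n) :
    ContDiffOn ℝ ∞ (fun y ↦ metricCoord e y i j) e.target :=
  contDiffOn_inner_mfderiv_symm he _ _

theorem metricCoord_symm (y : EuclideanSpace ℝ (Fin n)) (i j : Fin n) :
    metricCoord e y i j = metricCoord e y j i := by
  simp only [metricCoord, Matrix.of_apply]
  exact (real_inner_comm _ _).symm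

theorem mfderiv_symm_eq_sum (y v : EuclideanSpace ℝ (Fin n)) :
    mfderiv (𝓡 n) (𝓡 n) e.symm y v = ∑ i, v i • coordVec e i y := by
  have hv : v = ∑ i, v i • (EuclideanSpace.single i (1 : ℝ) : EuclideanSpace ℝ (Fin n)) := by
    simpa using ((EuclideanSpace.basisFun (Fin n) ℝ).sum_repr v).symm
  conv_lhs => rw [hv]
  exact (map_sum (mfderiv (𝓡 n) (𝓡 n) e.symm y) _ _).trans
    (Finset.sum_congr rfl fun i _ ↦ map_smul _ _ _)

theorem inner_mfderiv_symm (y v w : EuclideanSpace ℝ (Fin n)) :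
    (inner ℝ (mfderiv (𝓡 n) (𝓡 n) e.symm y v : TangentSpace (𝓡 n) (e.symm y))
      (mfderiv (𝓡 n) (𝓡 n) e.symm y w) : ℝ) = ∑ i, ∑ j, v i * w j * metricCoord e y i j := by
  rw [mfderiv_symm_eq_sum, mfderiv_symm_eq_sum]
  erw [sum_inner]
  refine Finset.sum_congr rfl fun i _ ↦ ?_
  erw [inner_sum]
  refine Finset.sum_congr rfl fun j _ ↦ ?_
  erw [inner_smul_left, inner_smul_right]
  simp [metricCoord, mul_assoc]

theorem metricCoord_posDef (he : e ∈ IsManifold.maximalAtlas (𝓡 n) ∞ M)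
    {y : EuclideanSpace ℝ (Fin n)} (hy : y ∈ e.target) : (metricCoord e y).PosDef := by
  refine Matrix.PosDef.of_dotProduct_mulVec_pos ?_ fun v hv ↦ ?_
  · ext i j
    simpa using metricCoord_symm y j i
  · have h1 := inner_mfderiv_symm (e := e) y (WithLp.toLp 2 v) (WithLp.toLp 2 v)
    have h2 : star v ⬝ᵥ metricCoord e y *ᵥ v = ∑ i, ∑ j, v i * v j * metricCoord e y i j := by
      simp only [dotProduct, Matrix.mulVec, Finset.mul_sum, star_trivial]
      exact Finset.sum_congr rfl fun i _ ↦ Finset.sum_congr rfl fun j _ ↦ by ring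
    rw [h2]
    refine lt_of_lt_of_eq ?_ h1
    refine real_inner_self_pos.mpr fun h0 ↦ hv ?_
    have h3 := mfderiv_chart_comp_symm he hy (WithLp.toLp 2 v)
    rw [h0, map_zero] at h3
    exact congrArg WithLp.ofLp h3.symm

theorem det_metricCoord_pos (he : e ∈ IsManifold.maximalAtlas (𝓡 n) ∞ M)
    {y : EuclideanSpace ℝ (Fin n)} (hy : y ∈ e.target) : 0 < (metricCoord e y).det :=
  (metricCoord_posDef he hy).det_pos

theorem inner_gradient (f : M → ℝ) (x : M) (v : TangentSpace (𝓡 n) x) :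
    (inner ℝ (gradient n f x) v : ℝ) = mfderiv (𝓡 n) 𝓘(ℝ) f x v := by
  have : FiniteDimensional ℝ (TangentSpace (𝓡 n) x) :=
    inferInstanceAs (FiniteDimensional ℝ (EuclideanSpace ℝ (Fin n)))
  have : CompleteSpace (TangentSpace (𝓡 n) x) := FiniteDimensional.complete ℝ _
  exact InnerProductSpace.toDual_symm_apply

variable (n) in
/-- The derivative `dψ(∇f) = ⟨∇f, ∇ψ⟩` of `ψ` in the direction of the gradient of `f`. -/
noncomputable def gradDeriv (f ψ : M → ℝ) (x : M) : ℝ := mfderiv (𝓡 n) 𝓘(ℝ) ψ x (gradient n f x)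

theorem gradDeriv_self (f : M → ℝ) (x : M) : gradDeriv n f f x = ‖gradient n f x‖ ^ 2 := by
  rw [gradDeriv, ← inner_gradient]
  exact real_inner_self_eq_norm_sq _

theorem fderiv_comp_chart_symm (he : e ∈ IsManifold.maximalAtlas (𝓡 n) ∞ M)
    {y : EuclideanSpace ℝ (Fin n)} (hy : y ∈ e.target) {f : M → ℝ}
    (hf : MDifferentiableAt (𝓡 n) 𝓘(ℝ) f (e.symm y)) (v : EuclideanSpace ℝ (Fin n)) :
    fderiv ℝ (fun z ↦ f (e.symm z)) y v =
      mfderiv (𝓡 n) 𝓘(ℝ) f (e.symm y) (mfderiv (𝓡 n) (𝓡 n) e.symm y v) := by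
  have h1 := mfderiv_comp y hf (mdifferentiableAt_chart_symm he hy)
  rw [mfderiv_eq_fderiv] at h1
  exact congrArg (fun L ↦ L v) h1

theorem mdifferentiableAt_of_comp_chart_symm (he : e ∈ IsManifold.maximalAtlas (𝓡 n) ∞ M)
    {y : EuclideanSpace ℝ (Fin n)} (hy : y ∈ e.target) {f : M → ℝ}
    (hf : DifferentiableAt ℝ (fun z ↦ f (e.symm z)) y) :
    MDifferentiableAt (𝓡 n) 𝓘(ℝ) f (e.symm y) := by
  have h1 : MDifferentiableAt (𝓡 n) 𝓘(ℝ) (fun z ↦ f (e.symm z)) (e (e.symm y)) := by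
    rw [e.right_inv hy]
    exact hf.mdifferentiableAt
  refine (h1.comp (e.symm y) (mdifferentiableAt_chart he (e.map_target hy))).congr_of_eventuallyEq
    ?_
  filter_upwards [e.open_source.mem_nhds (e.map_target hy)] with x hx
  simp [e.left_inv hx]

/-- Raising the index: both sides have the same inner product with every coordinate vector, and
these exhaust the tangent space. -/
theorem gradient_eq_mfderiv_symm (he : e ∈ IsManifold.maximalAtlas (𝓡 n) ∞ M)
    {y : EuclideanSpace ℝ (Fin n)} (hy : y ∈ e.target) {f : M → ℝ}
    (hf : MDifferentiableAt (𝓡 n) 𝓘(ℝ) f (e.symm y)) :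
    gradient n f (e.symm y) = mfderiv (𝓡 n) (𝓡 n) e.symm y
      (WithLp.toLp 2 fun i ↦
        ∑ j, (metricCoord e y)⁻¹ i j * partialD j (fun z ↦ f (e.symm z)) y) := by
  have hu : IsUnit (metricCoord e y).det := isUnit_iff_ne_zero.mpr (det_metricCoord_pos he hy).ne'
  refine ext_inner_right ℝ fun v ↦ ?_
  obtain ⟨w, rfl⟩ := mfderiv_symm_comp_chart he hy v
  rw [inner_gradient, ← fderiv_comp_chart_symm he hy hf]
  refine Eq.trans ?_ (inner_mfderiv_symm y _ _).symm
  have hw : w = ∑ i, w i • (EuclideanSpace.single i (1 : ℝ) : EuclideanSpace ℝ (Fin n)) := by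
    simpa using ((EuclideanSpace.basisFun (Fin n) ℝ).sum_repr w).symm
  have h1 : fderiv ℝ (fun z ↦ f (e.symm z)) y w =
      ∑ j, w j * partialD j (fun z ↦ f (e.symm z)) y := by
    conv_lhs => rw [hw]
    simp [partialD]
  rw [h1, Finset.sum_comm]
  refine Finset.sum_congr rfl fun j _ ↦ ?_
  set p : Fin n → ℝ := fun j ↦ partialD j (fun z ↦ f (e.symm z)) y
  have h2 : (metricCoord e y *ᵥ ((metricCoord e y)⁻¹ *ᵥ p)) j = p j := by
    rw [Matrix.mulVec_mulVec, Matrix.mul_nonsing_inv _ hu, Matrix.one_mulVec]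
  change w j * p j = _
  rw [← h2, Matrix.mulVec, dotProduct, Finset.mul_sum]
  refine Finset.sum_congr rfl fun i _ ↦ ?_
  rw [metricCoord_symm y j i]
  simp only [Matrix.mulVec, dotProduct, p]
  ring

/-- The coordinate expression `∑ᵢ (∑ⱼ gⁱʲ ∂ⱼ f) ∂ᵢ ψ` of `dψ(∇f)`. -/
theorem gradDeriv_eq_sum (he : e ∈ IsManifold.maximalAtlas (𝓡 n) ∞ M)
    {y : EuclideanSpace ℝ (Fin n)} (hy : y ∈ e.target) {f ψ : M → ℝ}
    (hf : MDifferentiableAt (𝓡 n) 𝓘(ℝ) f (e.symm y))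
    (hψ : MDifferentiableAt (𝓡 n) 𝓘(ℝ) ψ (e.symm y)) :
    gradDeriv n f ψ (e.symm y) =
      ∑ i, (∑ j, (metricCoord e y)⁻¹ i j * partialD j (fun z ↦ f (e.symm z)) y) *
        partialD i (fun z ↦ ψ (e.symm z)) y := by
  rw [gradDeriv, gradient_eq_mfderiv_symm he hy hf]
  refine (fderiv_comp_chart_symm he hy hψ _).symm.trans ?_
  set V : EuclideanSpace ℝ (Fin n) := WithLp.toLp 2 fun i ↦
    ∑ j, (metricCoord e y)⁻¹ i j * partialD j (fun z ↦ f (e.symm z)) y with hVdef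
  have hV : V = ∑ i, V i • (EuclideanSpace.single i (1 : ℝ) : EuclideanSpace ℝ (Fin n)) := by
    simpa using ((EuclideanSpace.basisFun (Fin n) ℝ).sum_repr V).symm
  rw [hV]
  simp [partialD, hVdef]

/-- Taking the trace of the soliton equation gives `Δf = n λ`. -/
theorem IsGradientTracelessRicciSoliton.sum_inv_mul_hessianCoord {f : M → ℝ} {lam : ℝ}
    (hs : IsGradientTracelessRicciSoliton (n := n) f lam)
    (he : e ∈ IsManifold.maximalAtlas (𝓡 n) ∞ M)
    {y : EuclideanSpace ℝ (Fin n)} (hy : y ∈ e.target) :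
    ∑ i, ∑ j, (metricCoord e y)⁻¹ i j * hessianCoord e f y i j = n * lam := by
  have hu : IsUnit (metricCoord e y).det := isUnit_iff_ne_zero.mpr (det_metricCoord_pos he hy).ne'
  have hn : (n : ℝ) ≠ 0 := by
    have := hs.dim
    exact_mod_cast (by omega : n ≠ 0)
  have htr : ∑ i, ∑ j, (metricCoord e y)⁻¹ i j * metricCoord e y i j = n := by
    have h := congrArg Matrix.trace (Matrix.nonsing_inv_mul _ hu)
    rw [Matrix.trace_one, Fintype.card_fin] at h
    rw [← h, Matrix.trace]
    refine Finset.sum_congr rfl fun i _ ↦ ?_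
    rw [Matrix.diag_apply, Matrix.mul_apply]
    exact Finset.sum_congr rfl fun j _ ↦ by rw [metricCoord_symm y i j]
  have heq : ∀ i j, hessianCoord e f y i j = (lam + 1 / (n : ℝ) * scalarCoord e y) *
      metricCoord e y i j - ricciCoord e y i j := fun i j ↦ by
    have := congrFun (congrFun (hs.equation e he y hy) i) j
    simp only [Matrix.add_apply, Matrix.sub_apply, Matrix.smul_apply, smul_eq_mul] at this
    linarith
  -- The trace is `(λ + R/n) n - R`; the value `1 / n` is exactly the one for which `R` drops out.
  calc ∑ i, ∑ j, (metricCoord e y)⁻¹ i j * hessianCoord e f y i j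
      = (lam + 1 / (n : ℝ) * scalarCoord e y) *
        ∑ i, ∑ j, (metricCoord e y)⁻¹ i j * metricCoord e y i j - scalarCoord e y := by
        rw [scalarCoord, Finset.mul_sum, ← Finset.sum_sub_distrib]
        refine Finset.sum_congr rfl fun i _ ↦ ?_
        rw [Finset.mul_sum, ← Finset.sum_sub_distrib]
        exact Finset.sum_congr rfl fun j _ ↦ by rw [heq]; simp only [scalarCoord]; ring
    _ = n * lam := by rw [htr]; field_simp; ring

end Charts

/-! ### The Riemannian volume in a chart. -/

section Volume

variable {n : ℕ} {M : Type u} [TopologicalSpace M] [ChartedSpace (EuclideanSpace ℝ (Fin n)) M]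
  [IsManifold (𝓡 n) ∞ M] [RiemannianBundle (fun x : M ↦ TangentSpace (𝓡 n) x)]
  {e e' : OpenPartialHomeomorph M (EuclideanSpace ℝ (Fin n))}

/-- The inner product of the tangent space at `x`, on the model space. -/
noncomputable def innerAt (x : M) (v w : EuclideanSpace ℝ (Fin n)) : ℝ :=
  @inner ℝ (TangentSpace (𝓡 n) x) _ v w

theorem differentiableAt_transition (he : e ∈ IsManifold.maximalAtlas (𝓡 n) ∞ M)
    (he' : e' ∈ IsManifold.maximalAtlas (𝓡 n) ∞ M) {y : EuclideanSpace ℝ (Fin n)}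
    (hy : y ∈ e'.target) (hy' : e'.symm y ∈ e.source) :
    DifferentiableAt ℝ (fun z ↦ e (e'.symm z)) y :=
  mdifferentiableAt_iff_differentiableAt.mp
    ((mdifferentiableAt_chart he hy').comp y (mdifferentiableAt_chart_symm he' hy))

theorem mfderiv_symm_transition (he : e ∈ IsManifold.maximalAtlas (𝓡 n) ∞ M)
    (he' : e' ∈ IsManifold.maximalAtlas (𝓡 n) ∞ M) {y : EuclideanSpace ℝ (Fin n)}
    (hy : y ∈ e'.target) (hy' : e'.symm y ∈ e.source) (v : EuclideanSpace ℝ (Fin n)) :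
    (mfderiv (𝓡 n) (𝓡 n) e'.symm y v : EuclideanSpace ℝ (Fin n)) =
      mfderiv (𝓡 n) (𝓡 n) e.symm (e (e'.symm y))
        (fderiv ℝ (fun z ↦ e (e'.symm z)) y v : EuclideanSpace ℝ (Fin n)) := by
  have h1 : HasMFDerivAt (𝓡 n) (𝓡 n) (fun z ↦ e (e'.symm z)) y
      (fderiv ℝ (fun z ↦ e (e'.symm z)) y) :=
    (differentiableAt_transition he he' hy hy').hasFDerivAt.hasMFDerivAt
  have h2 := (mdifferentiableAt_chart_symm he (e.map_source hy')).hasMFDerivAt.comp y h1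
  have hev : e'.symm =ᶠ[𝓝 y] e.symm ∘ fun z ↦ e (e'.symm z) := by
    filter_upwards [e'.symm.continuousAt hy (e.open_source.mem_nhds hy')] with z hz
      using (e.left_inv hz).symm
  exact congrArg (fun L ↦ L v) ((h2.congr_of_eventuallyEq hev).mfderiv)

/-- The Gram matrices are related by `G' = JᵀGJ` with `J` the Jacobian matrix of the transition map;
take determinants. -/
theorem sqrt_det_metricCoord_transition (he : e ∈ IsManifold.maximalAtlas (𝓡 n) ∞ M)
    (he' : e' ∈ IsManifold.maximalAtlas (𝓡 n) ∞ M) {y : EuclideanSpace ℝ (Fin n)}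
    (hy : y ∈ e'.target) (hy' : e'.symm y ∈ e.source) :
    √(metricCoord e' y).det = |(fderiv ℝ (fun z ↦ e (e'.symm z)) y).det| *
      √(metricCoord e (e (e'.symm y))).det := by
  set T := fderiv ℝ (fun z ↦ e (e'.symm z)) y
  set b := (EuclideanSpace.basisFun (Fin n) ℝ).toBasis
  set J : Matrix (Fin n) (Fin n) ℝ := LinearMap.toMatrix b b T.toLinearMap with hJ
  have hJap a i : J a i = T (EuclideanSpace.single i 1) a := by
    simp [hJ, b, LinearMap.toMatrix_apply]
  have hG : metricCoord e' y = Jᵀ * metricCoord e (e (e'.symm y)) * J := by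
    ext i j
    have h1 : metricCoord e' y i j = innerAt (e.symm (e (e'.symm y)))
        (mfderiv (𝓡 n) (𝓡 n) e.symm (e (e'.symm y)) (T (EuclideanSpace.single i 1)))
        (mfderiv (𝓡 n) (𝓡 n) e.symm (e (e'.symm y)) (T (EuclideanSpace.single j 1))) := by
      rw [e.left_inv hy']
      refine Eq.trans ?_ (congrArg₂ (innerAt (e'.symm y))
        (mfderiv_symm_transition he he' hy hy' (EuclideanSpace.single i 1))
        (mfderiv_symm_transition he he' hy hy' (EuclideanSpace.single j 1)))
      rfl
    rw [h1]
    refine (inner_mfderiv_symm (e := e) _ _ _).trans ?_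
    simp only [Matrix.mul_apply, Matrix.transpose_apply, hJap, Finset.sum_mul]
    rw [Finset.sum_comm]
    exact Finset.sum_congr rfl fun a _ ↦ Finset.sum_congr rfl fun b _ ↦ by ring
  have hdet : J.det = T.det := LinearMap.det_toMatrix b _
  rw [hG, Matrix.det_mul, Matrix.det_mul, Matrix.det_transpose, hdet, mul_right_comm,
    Real.sqrt_mul (mul_self_nonneg _), Real.sqrt_mul_self_eq_abs]

theorem measurableSet_target_inter_preimage [MeasurableSpace M] [BorelSpace M]
    (e : OpenPartialHomeomorph M (EuclideanSpace ℝ (Fin n))) {A : Set M} (hA : MeasurableSet A) :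
    MeasurableSet (e.target ∩ e.symm ⁻¹' A) := by
  have h := (continuousOn_iff_continuous_domRestrict.mp e.continuousOn_symm).measurable hA
  have h2 := e.open_target.measurableSet.subtype_image h
  convert! h2 using 1
  ext z
  simp [and_comm]

variable [MeasurableSpace M]

/-- The density `√(det g) dy¹ ⋯ dyⁿ` on the target of the chart `e`. -/
noncomputable def chartDensity (e : OpenPartialHomeomorph M (EuclideanSpace ℝ (Fin n))) :
    Measure (EuclideanSpace ℝ (Fin n)) :=
  (volume.restrict e.target).withDensity fun y ↦ ENNReal.ofReal √(metricCoord e y).det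

theorem chartVolume_eq_map (e : OpenPartialHomeomorph M (EuclideanSpace ℝ (Fin n))) :
    chartVolume e = (chartDensity e).map e.symm := rfl

theorem ae_chartDensity_mem_target (e : OpenPartialHomeomorph M (EuclideanSpace ℝ (Fin n))) :
    ∀ᵐ y ∂chartDensity e, y ∈ e.target :=
  (withDensity_absolutelyContinuous _ _).ae_le (ae_restrict_mem e.open_target.measurableSet)

variable [BorelSpace M]

theorem aemeasurable_chart_symm (e : OpenPartialHomeomorph M (EuclideanSpace ℝ (Fin n))) :
    AEMeasurable e.symm (chartDensity e) :=
  (e.continuousOn_symm.aemeasurable e.open_target.measurableSet).mono_ac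
    (withDensity_absolutelyContinuous _ _)

theorem chartVolume_apply (e : OpenPartialHomeomorph M (EuclideanSpace ℝ (Fin n))) {A : Set M}
    (hA : MeasurableSet A) :
    chartVolume e A = ∫⁻ y in e.target ∩ e.symm ⁻¹' A, ENNReal.ofReal √(metricCoord e y).det := by
  rw [chartVolume_eq_map, Measure.map_apply_of_aemeasurable (aemeasurable_chart_symm e) hA,
    chartDensity, withDensity_apply', Measure.restrict_restrict' e.open_target.measurableSet,
    Set.inter_comm]

theorem chartVolume_compl_source (e : OpenPartialHomeomorph M (EuclideanSpace ℝ (Fin n))) :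
    chartVolume e e.sourceᶜ = 0 := by
  rw [chartVolume_apply e e.open_source.measurableSet.compl]
  have : e.target ∩ e.symm ⁻¹' e.sourceᶜ = ∅ := by
    ext y
    simp only [Set.mem_inter_iff, Set.mem_preimage, Set.mem_compl_iff, Set.mem_empty_iff_false,
      iff_false, not_and, not_not]
    exact fun hy ↦ e.map_target hy
  rw [this, Measure.restrict_empty, lintegral_zero_measure]

/-- Change of variables along the transition map. Only an inequality holds, since the part of `A`
outside `e'.source` is invisible to `e'`. -/
theorem chartVolume_le_of_subset_source (he : e ∈ IsManifold.maximalAtlas (𝓡 n) ∞ M)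
    (he' : e' ∈ IsManifold.maximalAtlas (𝓡 n) ∞ M) {A : Set M} (hA : MeasurableSet A)
    (hAe : A ⊆ e.source) : chartVolume e' A ≤ chartVolume e A := by
  set S := e'.target ∩ e'.symm ⁻¹' A
  have hS : MeasurableSet S := measurableSet_target_inter_preimage e' hA
  have hinj : Set.InjOn (fun z ↦ e (e'.symm z)) S := fun y hy z hz h ↦
    e'.symm.injOn hy.1 hz.1 (e.injOn (hAe hy.2) (hAe hz.2) h)
  rw [chartVolume_apply e' hA, chartVolume_apply e hA]
  calc ∫⁻ y in S, ENNReal.ofReal √(metricCoord e' y).det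
      = ∫⁻ y in S, ENNReal.ofReal |(fderiv ℝ (fun z ↦ e (e'.symm z)) y).det| *
          ENNReal.ofReal √(metricCoord e (e (e'.symm y))).det := by
        refine setLIntegral_congr_fun hS fun y hy ↦ ?_
        rw [sqrt_det_metricCoord_transition he he' hy.1 (hAe hy.2),
          ENNReal.ofReal_mul (abs_nonneg _)]
    _ = ∫⁻ y in (fun z ↦ e (e'.symm z)) '' S, ENNReal.ofReal √(metricCoord e y).det :=
        (lintegral_image_eq_lintegral_abs_det_fderiv_mul volume hS (fun y hy ↦
          (differentiableAt_transition he he' hy.1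
            (hAe hy.2)).hasFDerivAt.hasFDerivWithinAt) hinj
          fun y ↦ ENNReal.ofReal √(metricCoord e y).det).symm
    _ ≤ _ := by
        refine lintegral_mono_set ?_
        rintro _ ⟨y, hy, rfl⟩
        refine ⟨e.map_source (hAe hy.2), ?_⟩
        simpa [e.left_inv (hAe hy.2)] using hy.2

/-- On the domain of a chart, the Riemannian volume is the volume of that chart. -/
theorem riemannianVolume_restrict_source (he : e ∈ IsManifold.maximalAtlas (𝓡 n) ∞ M) :
    (riemannianVolume n M).restrict e.source = chartVolume e := by
  have hms := e.open_source.measurableSet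
  have hself : (chartVolume e).restrict e.source = chartVolume e :=
    Measure.restrict_eq_self_of_ae_mem (chartVolume_compl_source e)
  apply le_antisymm
  · have hle : riemannianVolume n M ≤
        chartVolume e + ((∞ : ℝ≥0∞) • Measure.count).restrict e.sourceᶜ := by
      refine iSup₂_le fun e' he' ↦ Measure.le_iff.mpr fun A hA ↦ ?_
      rw [Measure.add_apply, Measure.restrict_apply hA]
      rcases Set.eq_empty_or_nonempty (A ∩ e.sourceᶜ) with h | h
      · have hAe : A ⊆ e.source := by
          rwa [← Set.disjoint_iff_inter_eq_empty, Set.disjoint_compl_right_iff_subset] at h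
        exact (chartVolume_le_of_subset_source he he' hA hAe).trans le_self_add
      · have h0 : Measure.count (A ∩ e.sourceᶜ) ≠ 0 := by
          rw [Ne, Measure.count_eq_zero_iff]
          exact h.ne_empty
        simp [ENNReal.top_mul h0]
    calc _ ≤ (chartVolume e + ((∞ : ℝ≥0∞) • Measure.count).restrict e.sourceᶜ).restrict
            e.source := Measure.restrict_mono_measure hle _
      _ = chartVolume e := by
          rw [Measure.restrict_add, hself, Measure.restrict_restrict hms, Set.inter_compl_self,
            Measure.restrict_empty, add_zero]
  · rw [← hself]
    exact Measure.restrict_mono_measure (le_iSup₂_of_le e he le_rfl) _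

theorem map_chart_riemannianVolume (he : e ∈ IsManifold.maximalAtlas (𝓡 n) ∞ M) :
    ((riemannianVolume n M).restrict e.source).map e = chartDensity e := by
  have h1 : AEMeasurable e ((riemannianVolume n M).restrict e.source) :=
    e.continuousOn.aemeasurable e.open_source.measurableSet
  rw [riemannianVolume_restrict_source he, chartVolume_eq_map] at h1 ⊢
  rw [AEMeasurable.map_map_of_aemeasurable h1 (aemeasurable_chart_symm e)]
  have h2 : e ∘ e.symm =ᵐ[chartDensity e] id := by
    filter_upwards [ae_chartDensity_mem_target e] with y hy using e.right_inv hy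
  rw [Measure.map_congr h2, Measure.map_id]

end Volume

/-! ### Locally Lipschitz functions. -/

section LocalLipschitz

/-- `f` is Lipschitz on some neighbourhood of `y`. -/
def LipschitzNear {X Y : Type*} [PseudoEMetricSpace X] [PseudoEMetricSpace Y] (f : X → Y) (y : X) :
    Prop :=
  ∃ K : ℝ≥0, ∃ t ∈ 𝓝 y, LipschitzOnWith K f t

variable {X : Type*} [PseudoEMetricSpace X] {f g : X → ℝ} {y : X}

theorem LipschitzNear.congr (hf : LipschitzNear f y) (h : f =ᶠ[𝓝 y] g) : LipschitzNear g y := by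
  obtain ⟨K, t, ht, hK⟩ := hf
  refine ⟨K, t ∩ {x | f x = g x}, inter_mem ht h, fun x hx z hz ↦ ?_⟩
  rw [← hx.2, ← hz.2]
  exact hK hx.1 hz.1

theorem LipschitzNear.continuousAt (hf : LipschitzNear f y) : ContinuousAt f y := by
  obtain ⟨K, t, ht, hK⟩ := hf
  exact hK.continuousOn.continuousAt ht

theorem LipschitzNear.mul (hf : LipschitzNear f y) (hg : LipschitzNear g y) :
    LipschitzNear (fun x ↦ f x * g x) y := by
  have hfg := hf.continuousAt.prodMk hg.continuousAt
  obtain ⟨K, t, ht, hK⟩ := hf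
  obtain ⟨L, s, hs, hL⟩ := hg
  have hmul : ContDiffAt ℝ 1 (fun p : ℝ × ℝ ↦ p.1 * p.2) (f y, g y) := by fun_prop
  obtain ⟨N, r, hr, hN⟩ := hmul.exists_lipschitzOnWith
  have hpair : LipschitzOnWith (max K L) (fun x ↦ (f x, g x)) (t ∩ s) :=
    (hK.mono inter_subset_left).prodMk (hL.mono inter_subset_right)
  refine ⟨N * max K L, (t ∩ s) ∩ (fun x ↦ (f x, g x)) ⁻¹' r, inter_mem (inter_mem ht hs)
    (hfg hr), ?_⟩
  exact hN.comp (hpair.mono inter_subset_left) fun x hx ↦ hx.2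

theorem lipschitzNear_of_contDiffAt {E : Type*} [NormedAddCommGroup E] [NormedSpace ℝ E]
    {f : E → ℝ} {y : E} (hf : ContDiffAt ℝ 1 f y) : LipschitzNear f y :=
  hf.exists_lipschitzOnWith

/-- Points at distance less than `1`, one of them in `K`, lie in a fixed compact ball, where local
Lipschitz bounds become uniform. For points farther apart the difference is at most twice the
supremum of `|w|`. -/
theorem exists_lipschitzWith_of_eq_zero_off_compact {E : Type*} [NormedAddCommGroup E]
    [NormedSpace ℝ E] [FiniteDimensional ℝ E] {w : E → ℝ} (hw : ∀ y, LipschitzNear w y)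
    {K : Set E} (hK : IsCompact K) (hzero : ∀ y ∉ K, w y = 0) : ∃ C, LipschitzWith C w := by
  obtain ⟨R, hR⟩ := hK.isBounded.subset_closedBall 0
  have hloc : LocallyLipschitz w := fun y ↦ hw y
  obtain ⟨C, hC⟩ := (hloc.locallyLipschitzOn (s := Metric.closedBall 0
    (R + 1))).exists_lipschitzOnWith_of_compact (isCompact_closedBall 0 (R + 1))
  obtain ⟨B, hB⟩ := hK.exists_bound_of_continuousOn hloc.continuous.continuousOn
  have hB' x : |w x| ≤ max B 0 := by
    by_cases hx : x ∈ K
    · exact (hB x hx).trans (le_max_left _ _)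
    · simp [hzero x hx]
  have key x z (hx : x ∈ K) :
      |w x - w z| ≤ max (C : ℝ) (2 * max B 0) * dist x z := by
    rcases lt_or_ge (dist x z) 1 with h | h
    · have hx' : x ∈ Metric.closedBall (0 : E) (R + 1) :=
        Metric.closedBall_subset_closedBall (by linarith) (hR hx)
      have hz' : z ∈ Metric.closedBall (0 : E) (R + 1) := by
        have := dist_triangle z x 0
        have h0 := hR hx
        rw [Metric.mem_closedBall] at h0 ⊢
        rw [dist_comm z x] at this
        linarith
      refine (hC.dist_le_mul x hx' z hz').trans ?_
      gcongr
      exact le_max_left _ _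
    · calc |w x - w z| ≤ |w x| + |w z| := abs_sub _ _
        _ ≤ (2 * max B 0) * 1 := by linarith [hB' x, hB' z]
        _ ≤ _ := by gcongr; exact le_max_right _ _
  refine ⟨⟨max (C : ℝ) (2 * max B 0), le_max_of_le_left C.2⟩, LipschitzWith.of_dist_le_mul
    fun x z ↦ ?_⟩
  rw [Real.dist_eq]
  by_cases hx : x ∈ K
  · exact key x z hx
  by_cases hz : z ∈ K
  · rw [abs_sub_comm, dist_comm]
    exact key z x hz
  · rw [hzero x hx, hzero z hz, sub_self, abs_zero]
    exact mul_nonneg (le_max_of_le_left C.2) dist_nonneg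

end LocalLipschitz

/-! ### Riemannian distance against coordinates, and the gradient bound for Lipschitz functions. -/

section Distance

variable {n : ℕ} {M : Type u} [MetricSpace M] [ChartedSpace (EuclideanSpace ℝ (Fin n)) M]
  [IsManifold (𝓡 n) ∞ M] [RiemannianBundle (fun x : M ↦ TangentSpace (𝓡 n) x)]
  {e : OpenPartialHomeomorph M (EuclideanSpace ℝ (Fin n))}

/-- The image under `e.symm` of the segment from `y` to `y + v` is a curve of length at most `c`. -/
theorem dist_chart_symm_le [IsRiemannianManifold (𝓡 n) M]
    (he : e ∈ IsManifold.maximalAtlas (𝓡 n) ∞ M) {y v : EuclideanSpace ℝ (Fin n)} {c : ℝ}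
    (hc : ∀ t ∈ Icc (0 : ℝ) 1, y + t • v ∈ e.target ∧
      ‖mfderiv (𝓡 n) (𝓡 n) e.symm (y + t • v) v‖ ≤ c) :
    dist (e.symm y) (e.symm (y + v)) ≤ c := by
  have hc0 : 0 ≤ c := (norm_nonneg _).trans (hc 0 (by simp)).2
  set l : ℝ → EuclideanSpace ℝ (Fin n) := fun t ↦ y + t • v with hl
  have hlsm : ContDiff ℝ 1 l := by fun_prop
  have hmaps : MapsTo l (Icc 0 1) e.target := fun t ht ↦ (hc t ht).1
  have hγ : ContMDiffOn 𝓘(ℝ) (𝓡 n) 1 (e.symm ∘ l) (Icc 0 1) :=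
    ((contMDiffOn_symm_of_mem_maximalAtlas he).of_le (by simp)).comp
      hlsm.contMDiff.contMDiffOn hmaps
  have h1 := Manifold.riemannianEDist_le_pathELength (I := 𝓡 n) (x := e.symm y)
    (y := e.symm (y + v)) hγ (by simp [hl]) (by simp [hl]) zero_le_one
  have h2 : Manifold.pathELength (𝓡 n) (e.symm ∘ l) 0 1 ≤ ENNReal.ofReal c := by
    rw [Manifold.pathELength_eq_lintegral_mfderiv_Icc]
    calc _ ≤ ∫⁻ _ in Icc (0 : ℝ) 1, ENNReal.ofReal c := by
          refine setLIntegral_mono' measurableSet_Icc fun t ht ↦ ?_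
          have hd : HasMFDerivAt 𝓘(ℝ) (𝓡 n) l t
              (ContinuousLinearMap.toSpanSingleton ℝ v) := by
            have : HasDerivAt l v t := by
              have := ((hasDerivAt_id t).smul_const v).const_add y
              rwa [one_smul] at this
            exact this.hasFDerivAt.hasMFDerivAt
          have h3 := (mdifferentiableAt_chart_symm he (hmaps ht)).hasMFDerivAt.comp t hd
          rw [h3.mfderiv, ← ofReal_norm]
          refine ENNReal.ofReal_le_ofReal (le_of_eq_of_le ?_ (hc t ht).2)
          exact congrArg (fun w ↦ ‖mfderiv (𝓡 n) (𝓡 n) e.symm (y + t • v) w‖) (one_smul ℝ v)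
      _ = ENNReal.ofReal c := by simp
  have h3 : edist (e.symm y) (e.symm (y + v)) ≤ ENNReal.ofReal c := by
    rw [IsRiemannianManifold.out (I := 𝓡 n)]
    exact h1.trans h2
  rwa [edist_dist, ENNReal.ofReal_le_ofReal_iff hc0] at h3

variable [IsContMDiffRiemannianBundle (𝓡 n) ∞ (EuclideanSpace ℝ (Fin n))
      (fun x : M ↦ TangentSpace (𝓡 n) x)]

theorem continuousOn_norm_mfderiv_symm (he : e ∈ IsManifold.maximalAtlas (𝓡 n) ∞ M)
    (v : EuclideanSpace ℝ (Fin n)) :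
    ContinuousOn (fun y ↦ ‖mfderiv (𝓡 n) (𝓡 n) e.symm y v‖) e.target := by
  refine ((contDiffOn_inner_mfderiv_symm he v v).continuousOn.sqrt).congr fun y hy ↦ ?_
  exact norm_eq_sqrt_real_inner _

theorem norm_mfderiv_symm_le (y v : EuclideanSpace ℝ (Fin n)) :
    ‖mfderiv (𝓡 n) (𝓡 n) e.symm y v‖ ≤ √(∑ i, ∑ j, |metricCoord e y i j|) * ‖v‖ := by
  have h1 : ‖mfderiv (𝓡 n) (𝓡 n) e.symm y v‖ ^ 2 ≤
      (∑ i, ∑ j, |metricCoord e y i j|) * ‖v‖ ^ 2 := by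
    refine le_of_eq_of_le ((real_inner_self_eq_norm_sq _).symm.trans (inner_mfderiv_symm y v v)) ?_
    simp_rw [Finset.sum_mul]
    refine Finset.sum_le_sum fun i _ ↦ Finset.sum_le_sum fun j _ ↦ ?_
    calc v i * v j * metricCoord e y i j ≤ |v i * v j * metricCoord e y i j| := le_abs_self _
      _ = |metricCoord e y i j| * (|v i| * |v j|) := by rw [abs_mul, abs_mul, mul_comm]
      _ ≤ |metricCoord e y i j| * ‖v‖ ^ 2 := by
          rw [sq]
          gcongr <;> exact PiLp.norm_apply_le v _
  have h2 : 0 ≤ ∑ i, ∑ j, |metricCoord e y i j| := by positivity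
  refine Real.le_sqrt_of_sq_le h1 |>.trans_eq ?_
  rw [Real.sqrt_mul h2, Real.sqrt_sq (norm_nonneg _)]

variable [IsRiemannianManifold (𝓡 n) M] {φ : M → ℝ} {K : ℝ≥0}

/-- On a small coordinate ball the metric coefficients are bounded, so `e.symm` is Lipschitz there;
convexity of the ball keeps the segments inside it. -/
theorem lipschitzNear_comp_chart_symm (he : e ∈ IsManifold.maximalAtlas (𝓡 n) ∞ M)
    (hφ : LipschitzWith K φ) {y : EuclideanSpace ℝ (Fin n)} (hy : y ∈ e.target) :
    LipschitzNear (fun z ↦ φ (e.symm z)) y := by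
  have hcont : ContinuousAt (fun z ↦ √(∑ i, ∑ j, |metricCoord e z i j|)) y := by
    refine ContinuousAt.sqrt (tendsto_finsetSum _ fun i _ ↦ tendsto_finsetSum _ fun j _ ↦ ?_)
    exact ((contDiffOn_metricCoord he i j).continuousOn.continuousAt
      (e.open_target.mem_nhds hy)).abs
  set B : ℝ := √(∑ i, ∑ j, |metricCoord e y i j|) + 1
  have hB : 0 ≤ B := by positivity
  have hev := (hcont.eventually_lt_const (show _ < B from lt_add_one _)).and
    (e.open_target.mem_nhds hy)
  obtain ⟨r, hr, hball⟩ := Metric.mem_nhds_iff.mp hev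
  suffices hlip : LipschitzOnWith ⟨B, hB⟩ e.symm (Metric.ball y r) from
    ⟨K * ⟨B, hB⟩, Metric.ball y r, Metric.ball_mem_nhds y hr, hφ.comp_lipschitzOnWith hlip⟩
  refine LipschitzOnWith.of_dist_le_mul fun x hx z hz ↦ ?_
  have h := dist_chart_symm_le he (y := x) (v := z - x) (c := B * dist x z) fun t ht ↦ by
    have hmem : x + t • (z - x) ∈ Metric.ball y r :=
      (convex_ball y r).add_smul_sub_mem hx hz ht
    refine ⟨(hball hmem).2, (norm_mfderiv_symm_le _ _).trans ?_⟩
    rw [dist_comm, dist_eq_norm]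
    gcongr
    exact (hball hmem).1.le
  have h' : dist (e.symm x) (e.symm z) ≤ B * dist x z := by simpa using h
  exact h'

/-- The constant is sharp, which keeps the final one universal. If `c` exceeds the Riemannian length
of the image of `v` at `y`, it still does so near `y`, so moving by `t • v` costs distance at most
`c|t|`. Difference quotients are then at most `K * c`, and `c` decreases to that length. -/
theorem abs_fderiv_le_of_lipschitzWith (he : e ∈ IsManifold.maximalAtlas (𝓡 n) ∞ M)
    (hφ : LipschitzWith K φ) {y : EuclideanSpace ℝ (Fin n)} (hy : y ∈ e.target)
    (hd : DifferentiableAt ℝ (fun z ↦ φ (e.symm z)) y) (v : EuclideanSpace ℝ (Fin n)) :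
    |fderiv ℝ (fun z ↦ φ (e.symm z)) y v| ≤ K * ‖mfderiv (𝓡 n) (𝓡 n) e.symm y v‖ := by
  have key (c : ℝ) (hc : ‖mfderiv (𝓡 n) (𝓡 n) e.symm y v‖ < c) :
      |fderiv ℝ (fun z ↦ φ (e.symm z)) y v| ≤ K * c := by
    have hc0 : 0 ≤ c := (norm_nonneg _).trans hc.le
    have hev := (((continuousOn_norm_mfderiv_symm he v).continuousAt
      (e.open_target.mem_nhds hy)).eventually_lt_const hc).and (e.open_target.mem_nhds hy)
    obtain ⟨r, hr, hball⟩ := Metric.mem_nhds_iff.mp hev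
    have hl : Tendsto (fun t : ℝ ↦ y + t • v) (𝓝 0) (𝓝 y) :=
      Continuous.tendsto' (by fun_prop) _ _ (by simp)
    have hline : HasDerivAt (fun t : ℝ ↦ φ (e.symm (y + t • v)))
        (fderiv ℝ (fun z ↦ φ (e.symm z)) y v) 0 := by
      have : HasLineDerivAt ℝ (fun z ↦ φ (e.symm z)) _ y v := hd.hasFDerivAt.hasLineDerivAt v
      exact this
    refine hline.le_of_lip' (mul_nonneg K.2 hc0) ?_
    filter_upwards [hl (Metric.ball_mem_nhds y hr)] with t ht
    have h := dist_chart_symm_le he (y := y) (v := t • v) (c := c * |t|) fun s hs ↦ by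
      have hmem : y + s • t • v ∈ Metric.ball y r := by
        simpa using (convex_ball y r).add_smul_sub_mem (Metric.mem_ball_self hr) ht hs
      refine ⟨(hball hmem).2, ?_⟩
      have h1 : mfderiv (𝓡 n) (𝓡 n) e.symm (y + s • t • v) (t • v) =
        t • mfderiv (𝓡 n) (𝓡 n) e.symm (y + s • t • v) v := map_smul _ _ _
      rw [h1, norm_smul, mul_comm, Real.norm_eq_abs]
      gcongr
      exact (hball hmem).1.le
    have h2 := hφ.dist_le_mul (e.symm (y + t • v)) (e.symm y)
    rw [dist_comm (e.symm _)] at h2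
    simp only [zero_smul, add_zero, sub_zero, Real.norm_eq_abs]
    rw [Real.dist_eq] at h2
    refine h2.trans ?_
    rw [mul_assoc]
    gcongr
  refine le_of_forall_pos_le_add fun ε hε ↦ ?_
  -- Dividing by `K + 1` rather than `K` covers `K = 0`.
  have h := key (‖mfderiv (𝓡 n) (𝓡 n) e.symm y v‖ + ε / (K + 1))
    (lt_add_of_pos_right _ (by positivity))
  refine h.trans ?_
  rw [mul_add]
  gcongr
  rw [← mul_div_assoc, div_le_iff₀ (by positivity)]
  nlinarith [K.2, hε]

theorem abs_gradDeriv_le (he : e ∈ IsManifold.maximalAtlas (𝓡 n) ∞ M)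
    (hφ : LipschitzWith K φ) {f : M → ℝ} {y : EuclideanSpace ℝ (Fin n)} (hy : y ∈ e.target)
    (hd : MDifferentiableAt (𝓡 n) 𝓘(ℝ) φ (e.symm y)) :
    |gradDeriv n f φ (e.symm y)| ≤ K * ‖gradient n f (e.symm y)‖ := by
  have hd' : DifferentiableAt ℝ (fun z ↦ φ (e.symm z)) y :=
    mdifferentiableAt_iff_differentiableAt.mp (hd.comp y (mdifferentiableAt_chart_symm he hy))
  obtain ⟨w, hw⟩ := mfderiv_symm_comp_chart he hy (gradient n f (e.symm y))
  have h := abs_fderiv_le_of_lipschitzWith he hφ hy hd' w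
  rw [hw] at h
  refine le_of_eq_of_le ?_ h
  rw [gradDeriv, ← hw, fderiv_comp_chart_symm he hy hd]

end Distance

/-! ### Integrals of line derivatives of Lipschitz functions. -/

theorem lineDeriv_const {E : Type*} [NormedAddCommGroup E] [NormedSpace ℝ E] (a : ℝ) (y v : E) :
    lineDeriv ℝ (fun _ : E ↦ a) y v = 0 := by
  simp [lineDeriv]

/-- Integration by parts against the constant function `1`. -/
theorem integral_lineDeriv_eq_zero {E : Type*} [NormedAddCommGroup E] [NormedSpace ℝ E]
    [FiniteDimensional ℝ E] [MeasurableSpace E] [BorelSpace E] {μ : Measure E}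
    [μ.IsAddHaarMeasure] {w : E → ℝ} {C : ℝ≥0} (hw : LipschitzWith C w)
    (hc : HasCompactSupport w) (v : E) : ∫ y, lineDeriv ℝ w y v ∂μ = 0 := by
  have h := LipschitzWith.integral_lineDeriv_mul_eq (μ := μ)
    (LipschitzWith.const (1 : ℝ) : LipschitzWith 0 fun _ : E ↦ (1 : ℝ)) hw hc (-v)
  simpa [lineDeriv_const] using h.symm

theorem integrable_lineDeriv {E : Type*} [NormedAddCommGroup E] [NormedSpace ℝ E]
    [FiniteDimensional ℝ E] [MeasurableSpace E] [BorelSpace E] {μ : Measure E}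
    [μ.IsAddHaarMeasure] {w : E → ℝ} {C : ℝ≥0} (hw : LipschitzWith C w)
    {K : Set E} (hK : IsCompact K) (hzero : ∀ y ∉ K, w y = 0) (v : E) :
    Integrable (fun y ↦ lineDeriv ℝ w y v) μ := by
  refine (integrableOn_iff_integrable_of_support_subset fun y hy ↦ ?_).mp
    ((hw.locallyIntegrable_lineDeriv v).integrableOn_isCompact hK)
  by_contra hyK
  have hev : w =ᶠ[𝓝 y] fun _ ↦ 0 := by
    filter_upwards [hK.isClosed.isOpen_compl.mem_nhds hyK] with z hz using hzero z hz
  exact hy (by simp [hev.lineDeriv_eq, lineDeriv_const])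

/-! ### Green's formula in a chart. -/

section Green

variable {n : ℕ} {M : Type u} [MetricSpace M] [ChartedSpace (EuclideanSpace ℝ (Fin n)) M]
  [IsManifold (𝓡 n) ∞ M] [RiemannianBundle (fun x : M ↦ TangentSpace (𝓡 n) x)]
  [IsContMDiffRiemannianBundle (𝓡 n) ∞ (EuclideanSpace ℝ (Fin n))
      (fun x : M ↦ TangentSpace (𝓡 n) x)]
  {e : OpenPartialHomeomorph M (EuclideanSpace ℝ (Fin n))} {f η : M → ℝ}

theorem contDiffAt_comp_chart_symm (he : e ∈ IsManifold.maximalAtlas (𝓡 n) ∞ M)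
    (hf : ContMDiff (𝓡 n) 𝓘(ℝ) ∞ f) {y : EuclideanSpace ℝ (Fin n)} (hy : y ∈ e.target) :
    ContDiffAt ℝ ∞ (fun z ↦ f (e.symm z)) y :=
  contMDiffAt_iff_contDiffAt.mp (hf.contMDiffAt.comp y
    ((contMDiffOn_symm_of_mem_maximalAtlas he).contMDiffAt (e.open_target.mem_nhds hy)))

theorem contDiffAt_partialD {h : EuclideanSpace ℝ (Fin n) → ℝ} {y : EuclideanSpace ℝ (Fin n)}
    (hh : ContDiffAt ℝ ∞ h y) (i : Fin n) : ContDiffAt ℝ 1 (partialD i h) y := by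
  have h1 : ContDiffAt ℝ 1 (fderiv ℝ h) y :=
    (contDiffAt_infty.mp hh 2).fderiv_right (m := 1) (by norm_num)
  exact h1.clm_apply contDiffAt_const

theorem contDiffAt_metricCoord (he : e ∈ IsManifold.maximalAtlas (𝓡 n) ∞ M)
    {y : EuclideanSpace ℝ (Fin n)} (hy : y ∈ e.target) (i j : Fin n) :
    ContDiffAt ℝ 1 (fun z ↦ metricCoord e z i j) y :=
  ((contDiffOn_metricCoord he i j).contDiffAt (e.open_target.mem_nhds hy)).of_le (by simp)

/-- The component `√(det g) ∑ⱼ gⁱʲ ∂ⱼ f` of the density-weighted gradient in the chart `e`. -/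
noncomputable def gradDensity (e : OpenPartialHomeomorph M (EuclideanSpace ℝ (Fin n)))
    (f : M → ℝ) (i : Fin n)
    (y : EuclideanSpace ℝ (Fin n)) : ℝ :=
  √(metricCoord e y).det *
    ∑ j, (metricCoord e y)⁻¹ i j * partialD j (fun z ↦ f (e.symm z)) y

theorem contDiffAt_sqrt_det (he : e ∈ IsManifold.maximalAtlas (𝓡 n) ∞ M)
    {y : EuclideanSpace ℝ (Fin n)} (hy : y ∈ e.target) :
    ContDiffAt ℝ 1 (fun z ↦ √(metricCoord e z).det) y :=
  (contDiffAt_matrix_det fun i j ↦ contDiffAt_metricCoord he hy i j).sqrt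
    (det_metricCoord_pos he hy).ne'

theorem contDiffAt_gradDensity (he : e ∈ IsManifold.maximalAtlas (𝓡 n) ∞ M)
    (hf : ContMDiff (𝓡 n) 𝓘(ℝ) ∞ f) {y : EuclideanSpace ℝ (Fin n)} (hy : y ∈ e.target)
    (i : Fin n) : ContDiffAt ℝ 1 (gradDensity e f i) y :=
  (contDiffAt_sqrt_det he hy).mul (ContDiffAt.sum fun j _ ↦
    (contDiffAt_matrix_inv (fun a b ↦ contDiffAt_metricCoord he hy a b)
      (det_metricCoord_pos he hy).ne' i j).mul
      (contDiffAt_partialD (contDiffAt_comp_chart_symm he hf hy) j))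

theorem sum_partialD_gradDensity (he : e ∈ IsManifold.maximalAtlas (𝓡 n) ∞ M)
    (hf : ContMDiff (𝓡 n) 𝓘(ℝ) ∞ f) {y : EuclideanSpace ℝ (Fin n)} (hy : y ∈ e.target) :
    ∑ i, partialD i (gradDensity e f i) y = √(metricCoord e y).det *
      ∑ i, ∑ j, (metricCoord e y)⁻¹ i j * hessianCoord e f y i j :=
  sum_partialD_sqrt_det_mul_grad (fun a b ↦ contDiffAt_metricCoord he hy a b)
    (fun z a b ↦ metricCoord_symm z a b) (det_metricCoord_pos he hy)
    fun j ↦ (contDiffAt_partialD (contDiffAt_comp_chart_symm he hf hy)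
      j).differentiableAt one_ne_zero

variable [MeasurableSpace M] [BorelSpace M]

theorem integrable_chartDensity_iff (he : e ∈ IsManifold.maximalAtlas (𝓡 n) ∞ M)
    {F : EuclideanSpace ℝ (Fin n) → ℝ} :
    Integrable F (chartDensity e) ↔
      IntegrableOn (fun y ↦ √(metricCoord e y).det * F y) e.target := by
  have hm : AEMeasurable (fun y ↦ Real.toNNReal √(metricCoord e y).det)
      (volume.restrict e.target) := by
    have : ContinuousOn (fun y ↦ √(metricCoord e y).det) e.target := fun y hy ↦
      (contDiffAt_sqrt_det he hy).continuousAt.continuousWithinAt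
    exact (this.aemeasurable e.open_target.measurableSet).real_toNNReal
  refine (integrable_withDensity_iff_integrable_smul₀ hm).trans ?_
  simp [IntegrableOn, NNReal.smul_def]

theorem integral_chartDensity (he : e ∈ IsManifold.maximalAtlas (𝓡 n) ∞ M)
    (F : EuclideanSpace ℝ (Fin n) → ℝ) :
    ∫ y, F y ∂chartDensity e = ∫ y in e.target, √(metricCoord e y).det * F y := by
  have hm : AEMeasurable (fun y ↦ Real.toNNReal √(metricCoord e y).det)
      (volume.restrict e.target) := by
    have : ContinuousOn (fun y ↦ √(metricCoord e y).det) e.target := fun y hy ↦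
      (contDiffAt_sqrt_det he hy).continuousAt.continuousWithinAt
    exact (this.aemeasurable e.open_target.measurableSet).real_toNNReal
  refine (integral_withDensity_eq_integral_smul₀ hm F).trans ?_
  simp [NNReal.smul_def]

theorem integral_comp_chart (he : e ∈ IsManifold.maximalAtlas (𝓡 n) ∞ M) {F : M → ℝ}
    (hF : ∀ x ∉ e.source, F x = 0) (hint : Integrable (fun y ↦ F (e.symm y)) (chartDensity e)) :
    Integrable F (riemannianVolume n M) ∧
      ∫ x, F x ∂riemannianVolume n M = ∫ y, F (e.symm y) ∂chartDensity e := by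
  have h1 : AEMeasurable e ((riemannianVolume n M).restrict e.source) :=
    e.continuousOn.aemeasurable e.open_source.measurableSet
  have h2 : (fun x ↦ F (e.symm (e x))) =ᵐ[(riemannianVolume n M).restrict e.source] F := by
    filter_upwards [ae_restrict_mem e.open_source.measurableSet] with x hx
    rw [e.left_inv hx]
  rw [← map_chart_riemannianVolume he] at hint ⊢
  have hsupp : Function.support F ⊆ e.source := fun x hx ↦ by
    by_contra h
    exact hx (hF x h)
  constructor
  · exact (integrableOn_iff_integrable_of_support_subset hsupp).mp
      ((hint.comp_aemeasurable h1).congr h2)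
  · rw [integral_map h1 hint.aestronglyMeasurable, integral_congr_ae h2,
      setIntegral_eq_integral_of_forall_compl_eq_zero hF]

theorem ae_of_ae_chart (he : e ∈ IsManifold.maximalAtlas (𝓡 n) ∞ M) {P : M → Prop}
    (hP : ∀ᵐ y ∂(volume : Measure (EuclideanSpace ℝ (Fin n))), y ∈ e.target → P (e.symm y)) :
    ∀ᵐ x ∂riemannianVolume n M, x ∈ e.source → P x := by
  have h1 : AEMeasurable e ((riemannianVolume n M).restrict e.source) :=
    e.continuousOn.aemeasurable e.open_source.measurableSet
  have h2 : ∀ᵐ y ∂chartDensity e, P (e.symm y) := by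
    filter_upwards [((withDensity_absolutelyContinuous _ _).trans
      Measure.absolutelyContinuous_restrict).ae_le hP, ae_chartDensity_mem_target e]
      with y hy hy' using hy hy'
  rw [← map_chart_riemannianVolume he] at h2
  rw [← ae_restrict_iff' e.open_source.measurableSet]
  filter_upwards [ae_of_ae_map h1 h2, ae_restrict_mem e.open_source.measurableSet] with x hx hx'
  rwa [e.left_inv hx'] at hx

theorem gradDeriv_eq_zero_of_notMem_tsupport {x : M} (hx : x ∉ tsupport η) :
    gradDeriv n f η x = 0 := by
  have hev : η =ᶠ[𝓝 x] fun _ ↦ 0 := notMem_tsupport_iff_eventuallyEq.mp hx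
  rw [gradDeriv, hev.mfderiv_eq, mfderiv_const]
  rfl

/-- Green's formula for a test function supported in a chart. -/
theorem integral_gradDeriv_of_tsupport_subset_source
    (he : e ∈ IsManifold.maximalAtlas (𝓡 n) ∞ M) (hf : ContMDiff (𝓡 n) 𝓘(ℝ) ∞ f) {c : ℝ}
    (hlap : ∀ y ∈ e.target, ∑ i, ∑ j, (metricCoord e y)⁻¹ i j * hessianCoord e f y i j = c)
    (hη : ∀ y ∈ e.target, LipschitzNear (fun z ↦ η (e.symm z)) y)
    (hcpt : IsCompact (tsupport η)) (hsub : tsupport η ⊆ e.source) :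
    Integrable (gradDeriv n f η) (riemannianVolume n M) ∧
      ∫ x, gradDeriv n f η x ∂riemannianVolume n M = -(c * ∫ x, η x ∂riemannianVolume n M) := by
  -- Extension by zero: off `e.target` the values of `e.symm` mean nothing.
  set u : EuclideanSpace ℝ (Fin n) → ℝ := e.target.indicator fun z ↦ η (e.symm z) with hu
  set K : Set (EuclideanSpace ℝ (Fin n)) := e '' tsupport η with hK
  have hKc : IsCompact K := hcpt.image_of_continuousOn (e.continuousOn.mono hsub)
  have hKt : K ⊆ e.target := by
    rintro _ ⟨x, hx, rfl⟩
    exact e.map_source (hsub hx)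
  have hmemK {y} (hy : y ∈ e.target) (hyK : y ∉ K) : e.symm y ∉ tsupport η := fun h ↦
    hyK ⟨e.symm y, h, e.right_inv hy⟩
  have hu0 y (hy : y ∉ K) : u y = 0 := by
    by_cases hyt : y ∈ e.target
    · rw [hu, indicator_of_mem hyt]
      exact image_eq_zero_of_notMem_tsupport (hmemK hyt hy)
    · exact indicator_of_notMem hyt _
  have hueq {y} (hy : y ∈ e.target) : (fun z ↦ η (e.symm z)) =ᶠ[𝓝 y] u := by
    filter_upwards [e.open_target.mem_nhds hy] with z hz
    rw [hu, indicator_of_mem hz]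
  -- The factor `a` is only controlled on `e.target`, but `u` vanishes off the compact set `K`
  -- inside it, so the product is globally Lipschitz.
  have hmul {a : EuclideanSpace ℝ (Fin n) → ℝ} (ha : ∀ y ∈ e.target, ContDiffAt ℝ 1 a y) :
      ∃ C, LipschitzWith C fun y ↦ a y * u y := by
    refine exists_lipschitzWith_of_eq_zero_off_compact (fun y ↦ ?_) hKc
      fun y hy ↦ by rw [hu0 y hy, mul_zero]
    by_cases hy : y ∈ e.target
    · exact (lipschitzNear_of_contDiffAt (ha y hy)).mul ((hη y hy).congr (hueq hy))
    · have hev : (fun _ ↦ (0 : ℝ)) =ᶠ[𝓝 y] fun z ↦ a z * u z := by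
        filter_upwards [hKc.isClosed.isOpen_compl.mem_nhds fun h ↦ hy (hKt h)] with z hz
        rw [hu0 z hz, mul_zero]
      exact (lipschitzNear_of_contDiffAt contDiffAt_const).congr hev
  have hmul0 (a : EuclideanSpace ℝ (Fin n) → ℝ) y (hy : y ∉ K) : a y * u y = 0 := by
    rw [hu0 y hy, mul_zero]
  obtain ⟨Cu, hCu⟩ : ∃ C, LipschitzWith C u := by
    simpa using hmul (a := fun _ ↦ 1) fun _ _ ↦ contDiffAt_const
  choose C hC using fun i ↦ hmul fun y hy ↦ contDiffAt_gradDensity he hf hy i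
  -- The Euclidean divergence of `u √(det g) ∇f`, a compactly supported Lipschitz field, so its
  -- integral vanishes.
  set W : EuclideanSpace ℝ (Fin n) → ℝ := fun y ↦ ∑ i, lineDeriv ℝ
    (fun y ↦ gradDensity e f i y * u y) y (EuclideanSpace.single i 1) with hW
  have hWint : Integrable W := integrable_finsetSum _ fun i _ ↦
    integrable_lineDeriv (hC i) hKc (hmul0 _) _
  have hW0 : ∫ y, W y = 0 := by
    rw [integral_finsetSum _ fun i _ ↦ integrable_lineDeriv (hC i) hKc (hmul0 _) _]
    exact Finset.sum_eq_zero fun i _ ↦ integral_lineDeriv_eq_zero (hC i)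
      (HasCompactSupport.intro hKc (hmul0 _)) _
  have hWout y (hy : y ∉ e.target) : W y = 0 := by
    refine Finset.sum_eq_zero fun i _ ↦ ?_
    have hev : (fun y ↦ gradDensity e f i y * u y) =ᶠ[𝓝 y] fun _ ↦ 0 := by
      filter_upwards [hKc.isClosed.isOpen_compl.mem_nhds fun h ↦ hy (hKt h)] with z hz
        using hmul0 _ z hz
    simp [hev.lineDeriv_eq, lineDeriv_const]
  -- At points of differentiability of `u`, the product rule and the divergence form of the
  -- Laplacian identify `W` with the density times `ηΔf + ⟨∇f, ∇η⟩`.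
  have hae : ∀ᵐ y ∂(volume.restrict e.target), W y = √(metricCoord e y).det *
      (c * η (e.symm y) + gradDeriv n f η (e.symm y)) := by
    filter_upwards [ae_restrict_mem e.open_target.measurableSet,
      ae_restrict_of_ae hCu.ae_differentiableAt] with y hy hd
    have hd' : DifferentiableAt ℝ (fun z ↦ η (e.symm z)) y :=
      hd.congr_of_eventuallyEq (hueq hy)
    have ha i : DifferentiableAt ℝ (gradDensity e f i) y :=
      (contDiffAt_gradDensity he hf hy i).differentiableAt one_ne_zero
    have hline i : lineDeriv ℝ (fun y ↦ gradDensity e f i y * u y) y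
        (EuclideanSpace.single i 1) = partialD i (gradDensity e f i) y * u y +
          gradDensity e f i y * partialD i u y := by
      rw [← partialD_mul (ha i) hd]
      exact ((ha i).mul hd).lineDeriv_eq_fderiv
    have hpu i : partialD i (fun z ↦ η (e.symm z)) y = partialD i u y := by
      rw [partialD, partialD, (hueq hy).fderiv_eq]
    rw [gradDeriv_eq_sum he hy (hf.mdifferentiableAt (by simp))
      (mdifferentiableAt_of_comp_chart_symm he hy hd')]
    simp_rw [hW, hline, hpu]
    rw [Finset.sum_add_distrib, ← Finset.sum_mul, sum_partialD_gradDensity he hf hy, hlap y hy,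
      show u y = η (e.symm y) from (hueq hy).eq_of_nhds.symm, mul_add, Finset.mul_sum, mul_assoc]
    simp_rw [gradDensity, mul_assoc]
  have hint1 : Integrable (fun y ↦ c * η (e.symm y) + gradDeriv n f η (e.symm y))
      (chartDensity e) :=
    (integrable_chartDensity_iff he).mpr (hWint.integrableOn.congr hae)
  have hzero1 : ∫ y, (c * η (e.symm y) + gradDeriv n f η (e.symm y)) ∂chartDensity e = 0 := by
    rw [integral_chartDensity he, ← integral_congr_ae hae,
      setIntegral_eq_integral_of_forall_compl_eq_zero hWout, hW0]
  have hint2 : Integrable (fun y ↦ η (e.symm y)) (chartDensity e) := by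
    obtain ⟨C', hC'⟩ := hmul fun y hy ↦ contDiffAt_sqrt_det he hy
    refine (integrable_chartDensity_iff he).mpr (IntegrableOn.congr_fun
      (hC'.continuous.integrable_of_hasCompactSupport
        (HasCompactSupport.intro hKc (hmul0 _))).integrableOn (fun y hy ↦ ?_)
      e.open_target.measurableSet)
    simp only [hu, indicator_of_mem hy]
  have hint3 : Integrable (fun y ↦ gradDeriv n f η (e.symm y)) (chartDensity e) := by
    exact (hint1.sub (hint2.const_mul c)).congr (Eventually.of_forall fun y ↦ by simp)
  have hη0 x (hx : x ∉ e.source) : η x = 0 :=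
    image_eq_zero_of_notMem_tsupport fun h ↦ hx (hsub h)
  obtain ⟨h1, h2⟩ := integral_comp_chart he (F := gradDeriv n f η)
    (fun x hx ↦ gradDeriv_eq_zero_of_notMem_tsupport fun h ↦ hx (hsub h)) hint3
  refine ⟨h1, ?_⟩
  rw [h2, (integral_comp_chart he hη0 hint2).2, eq_neg_iff_add_eq_zero, add_comm, ← hzero1,
    integral_add (hint2.const_mul c) hint3, integral_const_mul]

end Green

/-! ### Globalization and the Caccioppoli inequality. -/

section Caccioppoli

variable {n : ℕ} {M : Type u} [MetricSpace M] [ChartedSpace (EuclideanSpace ℝ (Fin n)) M]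
  [IsManifold (𝓡 n) ∞ M] [RiemannianBundle (fun x : M ↦ TangentSpace (𝓡 n) x)]
  {e : OpenPartialHomeomorph M (EuclideanSpace ℝ (Fin n))} {f φ : M → ℝ} {K : ℝ≥0}

theorem differentiableAt_comp_chart_symm (he : e ∈ IsManifold.maximalAtlas (𝓡 n) ∞ M)
    {y : EuclideanSpace ℝ (Fin n)} (hy : y ∈ e.target)
    (hφ : MDifferentiableAt (𝓡 n) 𝓘(ℝ) φ (e.symm y)) :
    DifferentiableAt ℝ (fun z ↦ φ (e.symm z)) y :=
  mdifferentiableAt_iff_differentiableAt.mp (hφ.comp y (mdifferentiableAt_chart_symm he hy))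

variable (n) in
theorem exists_chart_symm_eq (x : M) :
    ∃ e ∈ IsManifold.maximalAtlas (𝓡 n) ∞ M, ∃ y ∈ e.target, e.symm y = x :=
  ⟨chartAt _ x, IsManifold.chart_mem_maximalAtlas x, chartAt _ x x,
    (chartAt _ x).map_source (mem_chart_source _ x),
    (chartAt _ x).left_inv (mem_chart_source _ x)⟩

theorem gradDeriv_sum {ι : Type*} {s : Finset ι} {η : ι → M → ℝ} {x : M}
    (hf : MDifferentiableAt (𝓡 n) 𝓘(ℝ) f x)
    (hη : ∀ i ∈ s, MDifferentiableAt (𝓡 n) 𝓘(ℝ) (η i) x) :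
    gradDeriv n f (fun z ↦ ∑ i ∈ s, η i z) x = ∑ i ∈ s, gradDeriv n f (η i) x := by
  obtain ⟨e, he, y, hy, rfl⟩ := exists_chart_symm_eq n x
  have hd i (hi : i ∈ s) := differentiableAt_comp_chart_symm he hy (hη i hi)
  have hsum : MDifferentiableAt (𝓡 n) 𝓘(ℝ) (fun z ↦ ∑ i ∈ s, η i z) (e.symm y) :=
    mdifferentiableAt_of_comp_chart_symm he hy (DifferentiableAt.fun_sum hd)
  rw [gradDeriv_eq_sum he hy hf hsum,
    Finset.sum_congr rfl fun i hi ↦ gradDeriv_eq_sum he hy hf (hη i hi), Finset.sum_comm]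
  refine Finset.sum_congr rfl fun j _ ↦ ?_
  rw [partialD_sum hd, Finset.mul_sum]

theorem gradDeriv_mul {g h : M → ℝ} {x : M} (hg : MDifferentiableAt (𝓡 n) 𝓘(ℝ) g x)
    (hh : MDifferentiableAt (𝓡 n) 𝓘(ℝ) h x) :
    gradDeriv n f (fun z ↦ g z * h z) x =
      gradDeriv n f g x * h x + g x * gradDeriv n f h x := by
  have h1 := (hg.hasMFDerivAt.mul hh.hasMFDerivAt).mfderiv
  refine (congrArg (fun L ↦ L (gradient n f x)) h1).trans ?_
  change g x * gradDeriv n f h x + h x * gradDeriv n f g x = _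
  ring

variable [IsContMDiffRiemannianBundle (𝓡 n) ∞ (EuclideanSpace ℝ (Fin n))
      (fun x : M ↦ TangentSpace (𝓡 n) x)]

theorem continuous_norm_gradient_sq (hf : ContMDiff (𝓡 n) 𝓘(ℝ) ∞ f) :
    Continuous fun x ↦ ‖gradient n f x‖ ^ 2 := by
  simp_rw [← gradDeriv_self]
  refine continuous_iff_continuousAt.mpr fun x ↦ ?_
  have he := IsManifold.chart_mem_maximalAtlas (I := 𝓡 n) (n := ∞) x
  have hx := mem_chart_source (EuclideanSpace ℝ (Fin n)) x
  set e := chartAt (EuclideanSpace ℝ (Fin n)) x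
  have hy := e.map_source hx
  have h1 : ContinuousAt (fun y ↦ gradDeriv n f f (e.symm y)) (e x) := by
    have h2 : ContinuousAt (fun y ↦ ∑ i, (∑ j, (metricCoord e y)⁻¹ i j *
        partialD j (fun z ↦ f (e.symm z)) y) * partialD i (fun z ↦ f (e.symm z)) y) (e x) := by
      have hp j := contDiffAt_partialD (contDiffAt_comp_chart_symm he hf hy) j
      exact (ContDiffAt.sum fun i _ ↦ (ContDiffAt.sum fun j _ ↦
        (contDiffAt_matrix_inv (fun a b ↦ contDiffAt_metricCoord he hy a b)
          (det_metricCoord_pos he hy).ne' i j).mul (hp j)).mul (hp i)).continuousAt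
    refine h2.congr ?_
    filter_upwards [e.open_target.mem_nhds hy] with y hy'
    exact (gradDeriv_eq_sum he hy' (hf.mdifferentiableAt (by simp))
      (hf.mdifferentiableAt (by simp))).symm
  refine (h1.comp (e.continuousAt hx)).congr ?_
  filter_upwards [e.open_source.mem_nhds hx] with z hz
  simp [e.left_inv hz]

/-- Rademacher's theorem on a neighbourhood of each point; second countability passes from locally
null to null. -/
theorem ae_differentiableAt_of_lipschitzNear {E : Type*} [NormedAddCommGroup E]
    [NormedSpace ℝ E] [FiniteDimensional ℝ E] [MeasurableSpace E] [BorelSpace E]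
    {μ : Measure E} [μ.IsAddHaarMeasure] {g : E → ℝ} {U : Set E}
    (hg : ∀ y ∈ U, LipschitzNear g y) : ∀ᵐ y ∂μ, y ∈ U → DifferentiableAt ℝ g y := by
  have : SecondCountableTopology E := secondCountable_of_proper
  refine measure_null_of_locally_null _ fun y hy ↦ ?_
  simp only [compl_ofPred, Classical.not_imp, mem_ofPred_eq] at hy
  obtain ⟨K, t, ht, hK⟩ := hg y hy.1
  refine ⟨interior t ∩ {z | ¬ DifferentiableAt ℝ g z}, ?_, ?_⟩
  · refine mem_nhdsWithin.mpr ⟨interior t, isOpen_interior, mem_interior_iff_mem_nhds.mpr ht,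
      inter_subset_inter_right _ fun z hz ↦ ?_⟩
    simp only [compl_ofPred, Classical.not_imp, mem_ofPred_eq] at hz
    exact hz.2
  · refine measure_mono_null (fun z hz ↦ ?_) (ae_iff.mp
      ((hK.mono interior_subset).ae_differentiableWithinAt_of_mem (μ := μ)))
    rw [mem_ofPred_eq]
    intro h
    refine hz.2 ?_
    exact (h hz.1).differentiableAt (isOpen_interior.mem_nhds hz.1)

variable [MeasurableSpace M] [BorelSpace M]

/-- The density is bounded on a closed coordinate ball. This is what makes continuous functions
integrable on compact sets. -/
instance isLocallyFiniteMeasure_riemannianVolume :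
    IsLocallyFiniteMeasure (riemannianVolume n M) := by
  refine ⟨fun x ↦ ?_⟩
  have he := IsManifold.chart_mem_maximalAtlas (I := 𝓡 n) (n := ∞) x
  have hx := mem_chart_source (EuclideanSpace ℝ (Fin n)) x
  set e := chartAt (EuclideanSpace ℝ (Fin n)) x
  have hy := e.map_source hx
  obtain ⟨r, hr, hball⟩ := Metric.nhds_basis_closedBall.mem_iff.mp (e.open_target.mem_nhds hy)
  have hcont : ContinuousOn (fun y ↦ √(metricCoord e y).det) (Metric.closedBall (e x) r) :=
    fun y hy' ↦ (contDiffAt_sqrt_det he (hball hy')).continuousAt.continuousWithinAt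
  have h1 : chartDensity e (Metric.closedBall (e x) r) < ⊤ := by
    rw [chartDensity, withDensity_apply', Measure.restrict_restrict_of_subset hball]
    exact (hcont.integrableOn_compact (isCompact_closedBall _ _)).lintegral_lt_top
  refine ⟨e.source ∩ e ⁻¹' Metric.closedBall (e x) r, inter_mem (e.open_source.mem_nhds hx)
    (e.continuousAt hx (Metric.closedBall_mem_nhds _ hr)), ?_⟩
  have h2 : AEMeasurable e ((riemannianVolume n M).restrict e.source) :=
    e.continuousOn.aemeasurable e.open_source.measurableSet
  rwa [← map_chart_riemannianVolume he,
    Measure.map_apply_of_aemeasurable h2 measurableSet_closedBall,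
    Measure.restrict_apply' e.open_source.measurableSet, inter_comm] at h1

variable [IsRiemannianManifold (𝓡 n) M]

theorem ae_mdifferentiableAt_of_lipschitzWith [SecondCountableTopology M]
    (hφ : LipschitzWith K φ) :
    ∀ᵐ x ∂riemannianVolume n M, MDifferentiableAt (𝓡 n) 𝓘(ℝ) φ x := by
  refine measure_null_of_locally_null _ fun x _ ↦ ?_
  have he := IsManifold.chart_mem_maximalAtlas (I := 𝓡 n) (n := ∞) x
  have hx := mem_chart_source (EuclideanSpace ℝ (Fin n)) x
  set e := chartAt (EuclideanSpace ℝ (Fin n)) x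
  refine ⟨e.source ∩ {x | MDifferentiableAt (𝓡 n) 𝓘(ℝ) φ x}ᶜ,
    inter_mem (mem_nhdsWithin_of_mem_nhds (e.open_source.mem_nhds hx)) self_mem_nhdsWithin, ?_⟩
  have h := ae_of_ae_chart he (P := fun x ↦ MDifferentiableAt (𝓡 n) 𝓘(ℝ) φ x) (by
    filter_upwards [ae_differentiableAt_of_lipschitzNear (μ := volume)
      fun y hy ↦ lipschitzNear_comp_chart_symm he hφ hy] with y hd hy
    exact mdifferentiableAt_of_comp_chart_symm he hy (hd hy))
  refine measure_mono_null (fun z hz ↦ ?_) (ae_iff.mp h)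
  rw [mem_ofPred_eq]
  exact fun hzP ↦ hz.2 (hzP hz.1)

theorem abs_gradDeriv_le_of_lipschitzWith (hφ : LipschitzWith K φ) {x : M}
    (hd : MDifferentiableAt (𝓡 n) 𝓘(ℝ) φ x) :
    |gradDeriv n f φ x| ≤ K * ‖gradient n f x‖ := by
  obtain ⟨e, he, y, hy, rfl⟩ := exists_chart_symm_eq n x
  exact abs_gradDeriv_le he hφ hy hd

/-- If `Δf = c ≥ 0` and `f ≥ 0`, then `∫ ⟨∇f, ∇(φ² f)⟩ ≤ 0` for every compactly supported
Lipschitz function `φ`. -/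
theorem integral_gradDeriv_sq_mul_nonpos [SecondCountableTopology M]
    (hf : ContMDiff (𝓡 n) 𝓘(ℝ) ∞ f) {c : ℝ} (hc : 0 ≤ c)
    (hlap : ∀ e ∈ IsManifold.maximalAtlas (𝓡 n) ∞ M, ∀ y ∈ e.target,
      ∑ i, ∑ j, (metricCoord e y)⁻¹ i j * hessianCoord e f y i j = c)
    (hf0 : ∀ x, 0 ≤ f x) (hφ : LipschitzWith K φ) (hcpt : IsCompact (tsupport φ)) :
    Integrable (gradDeriv n f fun x ↦ φ x * φ x * f x) (riemannianVolume n M) ∧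
      ∫ x, gradDeriv n f (fun x ↦ φ x * φ x * f x) x ∂riemannianVolume n M ≤ 0 := by
  have : LocallyCompactSpace M := ChartedSpace.locallyCompactSpace (EuclideanSpace ℝ (Fin n)) M
  -- Cutting the test function into pieces supported in charts; only finitely many of them meet the
  -- compact support of `φ`.
  obtain ⟨ρ, hρ⟩ := SmoothPartitionOfUnity.exists_isSubordinate_chartAt_source (𝓡 n) M
  have hfin := ρ.locallyFinite.finite_nonempty_inter_compact hcpt
  set s := hfin.toFinset with hs
  set ψ : M → ℝ := fun x ↦ φ x * φ x * f x with hψ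
  set η : M → M → ℝ := fun i x ↦ ρ i x * ψ x with hη
  have hψ0 x (hx : x ∉ tsupport φ) : ψ x = 0 := by
    simp [hψ, image_eq_zero_of_notMem_tsupport hx]
  have hsum : ψ = fun x ↦ ∑ i ∈ s, η i x := by
    funext x
    by_cases hx : x ∈ tsupport φ
    · have h1 : ∑ i ∈ s, ρ i x = 1 := by
        rw [← ρ.sum_eq_one (mem_univ x)]
        refine (finsum_eq_sum_of_support_subset _ fun i hi ↦ ?_).symm
        rw [hs, Finite.coe_toFinset]
        exact ⟨x, hi, hx⟩
      simp only [hη]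
      rw [← Finset.sum_mul, h1, one_mul]
    · simp [hη, hψ0 x hx]
  have hψsupp : tsupport ψ ⊆ tsupport φ :=
    closure_minimal (fun x hx ↦ by_contra fun h ↦ hx (hψ0 x h)) (isClosed_tsupport φ)
  have hgreen i := integral_gradDeriv_of_tsupport_subset_source (η := η i) (c := c)
    (IsManifold.chart_mem_maximalAtlas (I := 𝓡 n) (n := ∞) i) hf (hlap _
      (IsManifold.chart_mem_maximalAtlas (I := 𝓡 n) (n := ∞) i)) (fun y hy ↦ by
        have he := IsManifold.chart_mem_maximalAtlas (I := 𝓡 n) (n := ∞) i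
        have h1 := lipschitzNear_comp_chart_symm he hφ hy
        exact (lipschitzNear_of_contDiffAt ((contDiffAt_comp_chart_symm he
          (ρ i).contMDiff hy).of_le (by simp))).mul ((h1.mul h1).mul
            (lipschitzNear_of_contDiffAt ((contDiffAt_comp_chart_symm he hf hy).of_le (by simp)))))
    (hcpt.of_isClosed_subset (isClosed_tsupport _)
      ((tsupport_mul_subset_right (f := ρ i) (g := ψ)).trans hψsupp))
    ((tsupport_mul_subset_left (f := ρ i) (g := ψ)).trans (hρ i))
  have hae : (fun x ↦ ∑ i ∈ s, gradDeriv n f (η i) x) =ᵐ[riemannianVolume n M]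
      gradDeriv n f ψ := by
    filter_upwards [ae_mdifferentiableAt_of_lipschitzWith (n := n) hφ] with x hx
    have hfx : MDifferentiableAt (𝓡 n) 𝓘(ℝ) f x := hf.mdifferentiableAt (by simp)
    rw [hsum, gradDeriv_sum hfx fun i _ ↦ ?_]
    exact ((ρ i).contMDiff.mdifferentiableAt (by simp)).mul ((hx.mul hx).mul hfx)
  refine ⟨(integrable_finsetSum s fun i _ ↦ (hgreen i).1).congr hae, ?_⟩
  rw [← integral_congr_ae hae, integral_finsetSum s fun i _ ↦ (hgreen i).1]
  -- Each piece `ρᵢφ²f` is itself nonnegative, so Green's formula makes every summand nonpositive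
  -- separately.
  refine Finset.sum_nonpos fun i _ ↦ ?_
  rw [(hgreen i).2, neg_nonpos]
  exact mul_nonneg hc (integral_nonneg fun x ↦ mul_nonneg (ρ.nonneg i x)
    (mul_nonneg (mul_self_nonneg _) (hf0 x)))

/-- The Caccioppoli inequality for nonnegative functions with constant Laplacian `c ≥ 0`. -/
theorem integral_norm_gradient_sq_le [SecondCountableTopology M]
    (hf : ContMDiff (𝓡 n) 𝓘(ℝ) ∞ f) {c : ℝ} (hc : 0 ≤ c)
    (hlap : ∀ e ∈ IsManifold.maximalAtlas (𝓡 n) ∞ M, ∀ y ∈ e.target,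
      ∑ i, ∑ j, (metricCoord e y)⁻¹ i j * hessianCoord e f y i j = c)
    (hf0 : ∀ x, 0 ≤ f x) (q : M) {r : ℝ} (hr : 0 < r)
    (hcpt : IsCompact (closure (Metric.ball q (2 * r)))) :
    IntegrableOn (fun x ↦ ‖gradient n f x‖ ^ 2) (Metric.ball q r) (riemannianVolume n M) ∧
      IntegrableOn (fun x ↦ f x ^ 2) (Metric.ball q (2 * r)) (riemannianVolume n M) ∧
      ∫ x in Metric.ball q r, ‖gradient n f x‖ ^ 2 ∂riemannianVolume n M ≤
        4 / r ^ 2 * ∫ x in Metric.ball q (2 * r), f x ^ 2 ∂riemannianVolume n M := by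
  have hsub : Metric.ball q r ⊆ Metric.ball q (2 * r) := Metric.ball_subset_ball (by linarith)
  have hi1 : IntegrableOn (fun x ↦ ‖gradient n f x‖ ^ 2) (Metric.ball q r)
      (riemannianVolume n M) :=
    ((continuous_norm_gradient_sq hf).continuousOn.integrableOn_compact hcpt).mono_set
      (hsub.trans subset_closure)
  have hi2 : IntegrableOn (fun x ↦ f x ^ 2) (Metric.ball q (2 * r)) (riemannianVolume n M) :=
    ((hf.continuous.pow 2).continuousOn.integrableOn_compact hcpt).mono_set subset_closure
  refine ⟨hi1, hi2, ?_⟩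
  -- The radial cutoff: `1` on `B(q,r)`, `0` off `B(q,2r)`, linear in the distance between.
  set φ : M → ℝ := fun x ↦ max 0 (min 1 (2 - dist x q / r)) with hφdef
  have hφ : LipschitzWith ⟨1 / r, by positivity⟩ φ := by
    refine LipschitzWith.const_max (LipschitzWith.const_min (LipschitzWith.of_dist_le_mul
      fun x z ↦ ?_) 1) 0
    rw [Real.dist_eq]
    have h1 : 2 - dist x q / r - (2 - dist z q / r) = 1 / r * (dist z q - dist x q) := by ring
    rw [h1, abs_mul, abs_of_pos (by positivity : 0 < 1 / r), dist_comm x z]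
    exact mul_le_mul_of_nonneg_left (abs_dist_sub_le z x q) (by positivity)
  have hφ0 x (hx : x ∉ Metric.ball q (2 * r)) : φ x = 0 := by
    rw [Metric.mem_ball, not_lt, ← le_div_iff₀ hr] at hx
    exact max_eq_left ((min_le_right _ _).trans (by linarith))
  have hφ1 x (hx : x ∈ Metric.ball q r) : φ x = 1 := by
    rw [Metric.mem_ball, ← div_lt_one hr] at hx
    rw [hφdef]
    simp only
    rw [min_eq_left (by linarith), max_eq_right zero_le_one]
  have hφle x : φ x ≤ 1 := max_le zero_le_one (min_le_left _ _)
  have hφnn x : 0 ≤ φ x := le_max_left _ _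
  have hφcpt : IsCompact (tsupport φ) := hcpt.of_isClosed_subset (isClosed_tsupport φ)
    (closure_mono fun x hx ↦ by_contra fun h ↦ hx (hφ0 x h))
  obtain ⟨hint, hle⟩ := integral_gradDeriv_sq_mul_nonpos hf hc hlap hf0 hφ hφcpt
  -- Young's inequality with weights that leave half of `φ²|∇f|²` after absorption.
  have hpt : ∀ᵐ x ∂riemannianVolume n M,
      1 / 2 * (Metric.ball q r).indicator (fun x ↦ ‖gradient n f x‖ ^ 2) x -
        2 / r ^ 2 * (Metric.ball q (2 * r)).indicator (fun x ↦ f x ^ 2) x ≤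
      gradDeriv n f (fun x ↦ φ x * φ x * f x) x := by
    filter_upwards [ae_mdifferentiableAt_of_lipschitzWith (n := n) hφ] with x hx
    have hfx : MDifferentiableAt (𝓡 n) 𝓘(ℝ) f x := hf.mdifferentiableAt (by simp)
    rw [gradDeriv_mul (g := fun x ↦ φ x * φ x) (hx.mul hx) hfx, gradDeriv_mul hx hx,
      gradDeriv_self]
    by_cases hxb : x ∈ Metric.ball q (2 * r)
    · have h1 : (Metric.ball q r).indicator (fun x ↦ ‖gradient n f x‖ ^ 2) x ≤
          φ x ^ 2 * ‖gradient n f x‖ ^ 2 := by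
        by_cases hxr : x ∈ Metric.ball q r
        · rw [indicator_of_mem hxr, hφ1 x hxr, one_pow, one_mul]
        · rw [indicator_of_notMem hxr]
          positivity
      rw [indicator_of_mem hxb]
      have h2 : |gradDeriv n f φ x| ≤ 1 / r * ‖gradient n f x‖ :=
        abs_gradDeriv_le_of_lipschitzWith hφ hx
      set D := gradDeriv n f φ x
      set N := ‖gradient n f x‖
      have h3 : -(2 * (φ x * f x) * (1 / r * N)) ≤ 2 * (φ x * f x) * D := by
        have h4 : 0 ≤ 2 * (φ x * f x) := by have := hφnn x; have := hf0 x; positivity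
        have := mul_le_mul_of_nonneg_left ((neg_le_neg h2).trans (neg_abs_le D)) h4
        linarith
      -- Expanded, this square is Young's inequality `2(φN)(f/r) ≤ ½(φN)² + 2(f/r)²`.
      have h5 : 0 ≤ 1 / 2 * (φ x * N - 2 * (f x / r)) ^ 2 := by positivity
      have h6 : 2 / r ^ 2 * f x ^ 2 = 2 * (f x / r) ^ 2 := by ring
      rw [h6]
      have h7 : 2 * (φ x * f x) * (1 / r * N) = 2 * (φ x * N) * (f x / r) := by ring
      nlinarith [h1, h3, h5, h7]
    · rw [indicator_of_notMem hxb, indicator_of_notMem fun h ↦ hxb (hsub h), hφ0 x hxb]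
      simp
  have hI1 := hi1.integrable_indicator measurableSet_ball
  have hI2 := hi2.integrable_indicator measurableSet_ball
  have hmono := (integral_mono_ae ((hI1.const_mul (1 / 2)).sub (hI2.const_mul (2 / r ^ 2)))
    hint hpt).trans hle
  simp only [Pi.sub_apply] at hmono
  rw [integral_sub (hI1.const_mul _) (hI2.const_mul _), integral_const_mul, integral_const_mul,
    integral_indicator measurableSet_ball, integral_indicator measurableSet_ball] at hmono
  have h8 : 4 / r ^ 2 = 2 * (2 / r ^ 2) := by ring
  rw [h8]
  linarith

end Caccioppoli

end RiemSoliton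

theorem mainTheorem5 :
    ∃ C : ℝ, ∀ (n : ℕ) (M : Type u) [MetricSpace M] [SecondCountableTopology M]
      [MeasurableSpace M] [BorelSpace M]
      [ChartedSpace (EuclideanSpace ℝ (Fin n)) M] [IsManifold (𝓡 n) ∞ M]
      [RiemannianBundle (fun x : M ↦ TangentSpace (𝓡 n) x)]
      [IsContMDiffRiemannianBundle (𝓡 n) ∞ (EuclideanSpace ℝ (Fin n))
        (fun x : M ↦ TangentSpace (𝓡 n) x)]
      [IsRiemannianManifold (𝓡 n) M]
      (f : M → ℝ) (lam : ℝ),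
      RiemSoliton.IsGradientTracelessRicciSoliton (n := n) f lam → 0 ≤ lam → (∀ x, 0 ≤ f x) →
      ∀ (q : M) (r : ℝ), 0 < r → IsCompact (closure (Metric.ball q (2 * r))) →
        IntegrableOn (fun x ↦ ‖RiemSoliton.gradient n f x‖ ^ 2) (Metric.ball q r)
            (RiemSoliton.riemannianVolume n M) ∧
        IntegrableOn (fun x ↦ f x ^ 2) (Metric.ball q (2 * r))
            (RiemSoliton.riemannianVolume n M) ∧
        ∫ x in Metric.ball q r, ‖RiemSoliton.gradient n f x‖ ^ 2
            ∂(RiemSoliton.riemannianVolume n M)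
          ≤ C / r ^ 2 * ∫ x in Metric.ball q (2 * r), f x ^ 2
            ∂(RiemSoliton.riemannianVolume n M) := by
  -- The constant is `2/r²` from Young's inequality divided by the remaining factor `½`.
  refine ⟨4, fun n M _ _ _ _ _ _ _ _ _ f lam hsol hlam hf0 q r hr hcpt ↦ ?_⟩
  exact RiemSoliton.integral_norm_gradient_sq_le hsol.smooth (c := n * lam) (by positivity)
    (fun e he y hy ↦ hsol.sum_inv_mul_hessianCoord he hy) hf0 q hr hcpt
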